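/- Let $\alpha$ be the real root and $\beta$ one of the two non-real roots of $x^3-2x^2-1$ (so $\alpha>1>|\beta|$). Put $\ell_A=\alpha^2-\alpha$, $\ell_B=\alpha$, $\ell_C=1$. Let $\Sigma\mathrm{Kol}(3,1)\subset\mathbb{R}$ be the set of left endpoints of the intervals in the tiling of $\mathbb{R}$ obtained from the bi-infinite fixed point $B|A\mapsto AB|ABC\mapsto ABCAB|ABCABB\mapsto\cdots$ of the substitution $A\mapsto ABC$, $B\mapsto AB$, $C\mapsto B$ by replacing each letter $i$ by an interval of length $\ell_i$, the seam $|$ being at the origin. Let $\Gamma\subset\mathbb{R}\times\mathbb{C}$ be the subgroup generated by $(\alpha^2-\alpha,\beta^2-\beta)$, $(\alpha,\beta)$ and $(1,1)$, and let $L^\star=\mathbb{Z}[\beta]$ be its projection to $\mathbb{C}$. For $W\subset\mathbb{C}$ put $\Lambda(W)=\{x\in\mathbb{R} : (x,z)\in\Gamma \text{ for some } z\in W\}$. Let $\Omega_A,\Omega_B,\Omega_C\subset\mathbb{C}$ be the unique non-empty compact sets with $$\Omega_A=\beta\Omega_A\cup\beta\Omega_B,\qquad \Omega_B=(\beta\Omega_A+\beta^2-\beta)\cup(\beta\Omega_B+\beta^2-\beta)\cup\beta\Omega_C,\qquad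 \Omega_C=\beta\Omega_A+\beta^2,$$ let $\Omega=\Omega_A\cup\Omega_B\cup\Omega_C$, and let $$C=\{c\in\mathbb{C} : (c+(\Omega\setminus(\Omega_A^\circ\cup\Omega_B^\circ\cup\Omega_C^\circ)))\cap L^\star=\varnothing\}.$$ For $\Lambda\subset\mathbb{R}$, $u\in\Lambda$ and $r>0$, the $r$-patch of $\Lambda$ at $u$ is $\Lambda\cap B_r(u)$. Two sets $\Lambda_1,\Lambda_2$ are locally indistinguishable (LI) if for all $r>0$ every $r$-patch of $\Lambda_1$ at a point $u$ is carried by the translation by $v-u$, for some $v\in\Lambda_2$, to the $r$-patch of $\Lambda_2$ at $v$, and vice versa. A set $\Lambda$ is repetitive if for every $r>0$ there is $R>0$ such that every ball of radius $R$ in $\mathbb{R}$ contains a translate (again an $r$-patch of $\Lambda$) of each $r$-patch of $\Lambda$. The set $\Lambda(W)$ is a generic model set if $\Gamma$ is a lattice (a discrete co-compact subgroup) in $\mathbb{R}\times\mathbb{C}$ whose projection to $\mathbb{R}$ is injective and whose projection to $\mathbb{C}$ is dense, $W$ is relatively compact with non-empty interior, $\partial W$ has Lebesgue measure zero, and $L^\star\cap\partial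 W=\varnothing$. Then $C$ is dense in $\mathbb{C}$, and: 1. for every $c\in C$, $\Lambda(c+\Omega)$ is repetitive and a generic model set; 2. for all $c,\tilde c\in C$, $\Lambda(c+\Omega)$ and $\Lambda(\tilde c+\Omega)$ are LI; 3. for every $c\in C$, $\Sigma\mathrm{Kol}(3,1)$ and $\Lambda(c+\Omega)$ are LI. -/

import Mathlib

namespace Kol

open Set MeasureTheory TopologicalSpace
open scoped NNReal ENNReal

/-! ### The substitution and its geometric realization -/

/-- The alphabet `{A, B, C}` (with `A = 33`, `B = 31`, `C = 11` in `Kol(3,1)`). -/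
inductive Letter : Type
  | A | B | C
  deriving DecidableEq

open Letter

instance : Fintype Letter := ⟨{A, B, C}, fun i => by cases i <;> simp⟩

/-- The substitution `A ↦ ABC`, `B ↦ AB`, `C ↦ B`. -/
def subst : Letter → List Letter
  | A => [A, B, C]
  | B => [A, B]
  | C => [B]

/-- The substitution, extended to words by concatenation. -/
def substWord (w : List Letter) : List Letter := w.flatMap subst

/-- `x² - x`, `x`, `1`. For `x = α` these are the natural bond lengths `ℓ_A, ℓ_B, ℓ_C`,
for `x = β` their Galois conjugates. -/
def bond {R : Type*} [CommRing R] (x : R) : Letter → R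
  | A => x ^ 2 - x
  | B => x
  | C => 1

/-- The length of the word `w` in the geometric realization. -/
def wordLength (α : ℝ) (w : List Letter) : ℝ := (w.map (bond α)).sum

/-- The left endpoints of the intervals of type `i` in the geometric realization of the
bi-infinite fixed point `B|A ↦ AB|ABC ↦ ABCAB|ABCABB ↦ ⋯`, the seam `|` being at the origin.
The words `σⁿ(A)` to the right of the seam extend each other to the right, the words `σⁿ(B)` to
its left extend each other to the left. -/
def endpoints (α : ℝ) (i : Letter) : Set ℝ :=
  {x | ∃ (n : ℕ) (u v : List Letter), substWord^[n] [A] = u ++ i :: v ∧ x = wordLength α u} ∪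
  {x | ∃ (n : ℕ) (u v : List Letter), substWord^[n] [B] = u ++ i :: v ∧
    x = -wordLength α (i :: v)}

/-- The point set `ΣKol(3,1)` of all left endpoints. -/
def sigmaKol (α : ℝ) : Set ℝ := ⋃ i, endpoints α i

/-! ### Cut-and-project schemes with physical space `ℝ` and internal space `ℂ` -/

/-- `Γ` is a lattice (a discrete co-compact subgroup) in `ℝ × ℂ`, the projection to physical
space is one-to-one on `Γ`, and the projection of `Γ` to internal space is dense. -/
structure IsCutProjectScheme (Γ : AddSubgroup (ℝ × ℂ)) : Prop where
  discrete : DiscreteTopology Γ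
  cocompact : CompactSpace ((ℝ × ℂ) ⧸ Γ)
  injOn_fst : InjOn Prod.fst (Γ : Set (ℝ × ℂ))
  dense_snd : Dense (Prod.snd '' (Γ : Set (ℝ × ℂ)))

/-- The cut-and-project set `Λ(W) = {π(x) | x ∈ Γ, π_int(x) ∈ W}`. -/
def modelSet (Γ : AddSubgroup (ℝ × ℂ)) (W : Set ℂ) : Set ℝ :=
  {x | ∃ z ∈ W, (x, z) ∈ Γ}

/-- `Λ(W)` is a model set: the window is relatively compact with non-empty interior. -/
structure IsModelSet (Γ : AddSubgroup (ℝ × ℂ)) (W : Set ℂ) : Prop where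
  scheme : IsCutProjectScheme Γ
  relativelyCompact : IsCompact (closure W)
  interior_nonempty : (interior W).Nonempty

/-- `Λ(W)` is a regular model set. -/
structure IsRegularModelSet (Γ : AddSubgroup (ℝ × ℂ)) (W : Set ℂ) : Prop
    extends IsModelSet Γ W where
  volume_frontier : volume (frontier W) = 0

/-- `Λ(W)` is a generic (non-singular) model set. -/
structure IsGenericModelSet (Γ : AddSubgroup (ℝ × ℂ)) (W : Set ℂ) : Prop
    extends IsRegularModelSet Γ W where
  nonsingular : Prod.snd '' (Γ : Set (ℝ × ℂ)) ∩ frontier W = ∅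

/-! ### Patches, local indistinguishability, repetitivity -/

/-- The `r`-patch of `Λ` at `u`. -/
def patch (Λ : Set ℝ) (r u : ℝ) : Set ℝ := Λ ∩ Metric.ball u r

/-- Every patch of `Λ₁` occurs, up to translation, as a patch of `Λ₂`. -/
def PatchesOccur (Λ₁ Λ₂ : Set ℝ) : Prop :=
  ∀ r > 0, ∀ u ∈ Λ₁, ∃ v ∈ Λ₂, patch Λ₂ r v = (fun x => x + (v - u)) '' patch Λ₁ r u

/-- `Λ₁` and `Λ₂` are locally indistinguishable (LI). -/
def LocallyIndistinguishable (Λ₁ Λ₂ : Set ℝ) : Prop :=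
  PatchesOccur Λ₁ Λ₂ ∧ PatchesOccur Λ₂ Λ₁

/-- `Λ` is repetitive: every ball of radius `R(r)` contains a translate of each `r`-patch. -/
def Repetitive (Λ : Set ℝ) : Prop :=
  ∀ r > 0, ∃ R > 0, ∀ y : ℝ, ∀ u ∈ Λ, ∃ v ∈ Λ,
    patch Λ r v = (fun x => x + (v - u)) '' patch Λ r u ∧ patch Λ r v ⊆ Metric.ball y R

/-! ### The lattice and the windows -/

/-- The lattice `Γ = ℤ v_A + ℤ v_B + ℤ v_C` in `ℝ × ℂ`. -/
def lattice (α : ℝ) (β : ℂ) : AddSubgroup (ℝ × ℂ) :=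
  AddSubgroup.closure (range fun i : Letter => (bond α i, bond β i))

/-- `Ω` is a solution in non-empty compact sets of the iterated function system
`Ω_A = β Ω_A ∪ β Ω_B`, `Ω_B = (β Ω_A + β² - β) ∪ (β Ω_B + β² - β) ∪ β Ω_C`,
`Ω_C = β Ω_A + β²` induced by the substitution. -/
structure IsWindowSystem (β : ℂ) (Ω : Letter → Set ℂ) : Prop where
  isCompact : ∀ i, IsCompact (Ω i)
  nonempty : ∀ i, (Ω i).Nonempty
  eq_A : Ω A = (fun z => β * z) '' Ω A ∪ (fun z => β * z) '' Ω B
  eq_B : Ω B = (fun z => β * z + (β ^ 2 - β)) '' Ω A ∪ (fun z => β * z + (β ^ 2 - β)) '' Ω B ∪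
    (fun z => β * z) '' Ω C
  eq_C : Ω C = (fun z => β * z + β ^ 2) '' Ω A

/-- The map `z ↦ β z + t` on non-empty compact sets. -/
noncomputable def affMap (β t : ℂ) (K : NonemptyCompacts ℂ) : NonemptyCompacts ℂ :=
  K.map (fun z => β * z + t) (by fun_prop)

theorem edist_affMap_le (β t : ℂ) (K K' : NonemptyCompacts ℂ) :
    edist (affMap β t K) (affMap β t K') ≤ ‖β‖₊ * edist K K' := by
  have hz : ∀ x y : ℂ, edist (β * x + t) (β * y + t) = ‖β‖₊ * edist x y := by
    intro x y
    rw [edist_add_right, edist_eq_enorm_sub, edist_eq_enorm_sub, ← mul_sub, enorm_mul]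
    rfl
  have key : ∀ K K' : NonemptyCompacts ℂ, ∀ w ∈ (affMap β t K : Set ℂ),
      Metric.infEDist w (affMap β t K' : Set ℂ) ≤ ‖β‖₊ * edist K K' := by
    intro K K' w hw
    obtain ⟨x, hx, rfl⟩ := hw
    obtain ⟨y, hy, hxy⟩ := K'.isCompact.exists_infEDist_eq_edist K'.nonempty x
    refine (Metric.infEDist_le_edist_of_mem (Set.mem_image_of_mem (fun z => β * z + t) hy)).trans ?_
    rw [hz, ← hxy]
    gcongr
    exact Metric.infEDist_le_hausdorffEDist_of_mem hx
  refine Metric.hausdorffEDist_le_of_infEDist (key K K') fun w hw => ?_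
  rw [edist_comm]
  exact key K' K w hw

/-- One step of the iterated function system, on triples of non-empty compact sets. -/
noncomputable def ifsStep (β : ℂ) (K : Letter → NonemptyCompacts ℂ) :
    Letter → NonemptyCompacts ℂ
  | A => affMap β 0 (K A) ⊔ affMap β 0 (K B)
  | B => affMap β (β ^ 2 - β) (K A) ⊔ affMap β (β ^ 2 - β) (K B) ⊔ affMap β 0 (K C)
  | C => affMap β (β ^ 2) (K A)

theorem contracting_ifsStep {β : ℂ} (hβ : ‖β‖ < 1) : ContractingWith ‖β‖₊ (ifsStep β) := by
  refine ⟨by exact_mod_cast hβ, fun K K' => ?_⟩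
  have h1 : ∀ (i : Letter) (t : ℂ),
      edist (affMap β t (K i)) (affMap β t (K' i)) ≤ ‖β‖₊ * edist K K' := fun i t =>
    (edist_affMap_le β t _ _).trans (by gcongr; exact edist_le_pi_edist K K' i)
  have h2 : ∀ {a b a' b' : NonemptyCompacts ℂ} {r : ℝ≥0∞}, edist a a' ≤ r → edist b b' ≤ r →
      edist (a ⊔ b) (a' ⊔ b') ≤ r := fun ha hb =>
    Metric.hausdorffEDist_union_le.trans (max_le ha hb)
  refine edist_pi_le_iff.2 fun i => ?_
  cases i
  · exact h2 (h1 _ _) (h1 _ _)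
  · exact h2 (h2 (h1 _ _) (h1 _ _)) (h1 _ _)
  · exact h1 _ _

theorem isWindowSystem_iff_isFixedPt (β : ℂ) (K : Letter → NonemptyCompacts ℂ) :
    IsWindowSystem β (fun i => (K i : Set ℂ)) ↔ Function.IsFixedPt (ifsStep β) K := by
  have e : ∀ i, (ifsStep β K i : Set ℂ) = K i ↔ ifsStep β K i = K i := fun i =>
    SetLike.coe_set_eq
  constructor
  · intro h
    funext i
    rw [← e]
    cases i
    · simpa [ifsStep, affMap] using h.eq_A.symm
    · simpa [ifsStep, affMap] using h.eq_B.symm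
    · simpa [ifsStep, affMap] using h.eq_C.symm
  · intro h
    have h' : ∀ i, (ifsStep β K i : Set ℂ) = K i := fun i => (e i).2 (congrFun h i)
    refine ⟨fun i => (K i).isCompact, fun i => (K i).nonempty, ?_, ?_, ?_⟩
    · simpa [ifsStep, affMap] using (h' A).symm
    · simpa [ifsStep, affMap] using (h' B).symm
    · simpa [ifsStep, affMap] using (h' C).symm

/-- Hutchinson's theorem for this iterated function system. -/
theorem existsUnique_isWindowSystem {β : ℂ} (hβ : ‖β‖ < 1) : ∃! Ω, IsWindowSystem β Ω := by
  have hc := contracting_ifsStep hβ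
  have : Nonempty (Letter → NonemptyCompacts ℂ) := ⟨fun _ => {0}⟩
  refine ⟨fun i => (hc.fixedPoint (ifsStep β) i : Set ℂ),
    (isWindowSystem_iff_isFixedPt β _).2 hc.fixedPoint_isFixedPt, fun Ω hΩ => ?_⟩
  let K : Letter → NonemptyCompacts ℂ := fun i => ⟨⟨Ω i, hΩ.isCompact i⟩, hΩ.nonempty i⟩
  have hK : K = hc.fixedPoint (ifsStep β) :=
    hc.fixedPoint_unique ((isWindowSystem_iff_isFixedPt β K).1 hΩ)
  funext i
  rw [← hK]
  rfl

/-- A non-real root of `x³ - 2x² - 1` has modulus less than one. -/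
theorem norm_lt_one_of_root {β : ℂ} (h : β ^ 3 - 2 * β ^ 2 - 1 = 0) (him : β.im ≠ 0) :
    ‖β‖ < 1 := by
  obtain ⟨a, b⟩ := β
  have hre := congrArg Complex.re h
  have hi := congrArg Complex.im h
  simp [pow_succ] at hre hi him
  have h1 : 3 * a ^ 2 - b ^ 2 - 4 * a = 0 := by
    apply mul_left_cancel₀ him
    linear_combination hi
  have h2 : -8 * a * (1 - a) ^ 2 = 1 := by
    linear_combination hre + (3 * a - 2) * (-h1)
  have ha : a < 0 := by
    by_contra hcon
    nlinarith [mul_nonneg (not_lt.1 hcon) (sq_nonneg (1 - a))]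
  have h3 : a * a + b * b < 1 := by nlinarith [mul_pos (neg_pos.2 ha) (neg_pos.2 ha)]
  have h4 : ‖(⟨a, b⟩ : ℂ)‖ ^ 2 < 1 := by
    rw [Complex.sq_norm, Complex.normSq_mk]
    exact h3
  nlinarith [norm_nonneg (⟨a, b⟩ : ℂ)]

/-- The windows `Ω_A, Ω_B, Ω_C`: the solution of the iterated function system in non-empty compact
sets. There is exactly one for `‖β‖ < 1`; being written as a union over all solutions, the
definition needs neither a choice nor a proof of `‖β‖ < 1`. -/
def window (β : ℂ) (i : Letter) : Set ℂ :=
  {z | ∃ Ω : Letter → Set ℂ, IsWindowSystem β Ω ∧ z ∈ Ω i}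

theorem window_eq {β : ℂ} (hβ : ‖β‖ < 1) {Ω : Letter → Set ℂ} (hΩ : IsWindowSystem β Ω) :
    window β = Ω := by
  funext i
  ext z
  constructor
  · rintro ⟨Ω', h', hz⟩
    rwa [(existsUnique_isWindowSystem hβ).unique hΩ h']
  · exact fun hz => ⟨Ω, hΩ, hz⟩

theorem isWindowSystem_window {β : ℂ} (hβ : ‖β‖ < 1) : IsWindowSystem β (window β) := by
  obtain ⟨Ω, hΩ, -⟩ := existsUnique_isWindowSystem hβ
  rwa [window_eq hβ hΩ]

/-- `Ω = Ω_A ∪ Ω_B ∪ Ω_C`. -/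
def totalWindow (β : ℂ) : Set ℂ := ⋃ i, window β i

/-- The union of the interiors of `Ω_A`, `Ω_B` and `Ω_C`. -/
def innerWindow (β : ℂ) : Set ℂ := ⋃ i, interior (window β i)

/-- The set `C` of the shifts `c` such that `c + (Ω ∖ (int Ω_A ∪ int Ω_B ∪ int Ω_C))` contains no
point of `L⋆ = π_int(Γ)`. -/
def genericShifts (α : ℝ) (β : ℂ) : Set ℂ :=
  {c | ((fun z => c + z) '' (totalWindow β \ innerWindow β)) ∩
    Prod.snd '' (lattice α β : Set (ℝ × ℂ)) = ∅}

/-- The window `c + Ω`. -/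
def shiftedWindow (β c : ℂ) : Set ℂ := (fun z => c + z) '' totalWindow β

end Kol

/-! The theorem rests on the exact identity `sigmaKol_eq_modelSet`: the left endpoints of type `i`
are precisely the lattice points whose conjugate lies in Ω_i. Identify the lattice with ℤ³ by
integer coordinates, so that inflation acts as multiplication by α on the physical side and by β on
the internal side. Conjugates of tile positions stay in the windows because the two seam tiles are
fixed under inflation and the windows satisfy the same recursion (`evalAt_mem_window`). Conversely,
a lattice point in a window that is no tile position has a parent of the same kind. Taking parents
contracts the physical coordinate while the internal one stays in a bounded window, so an endless
ancestry would enter a finite box of lattice points, and a finite search excludes it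
(`mem_positions_of_mem_window`).

The second pillar is `evalAt_mem_interior_window`: a lattice point in Ω_i is interior to Ω_i. The
tiles cover the line without overlap, so every lattice point is a tile position plus one of finitely
many offsets once its internal part is confined. Closedness of the windows transfers the tile type
from any nearby lattice point back to the given one. Hence 0 is a generic shift, and so is all of
L⋆, which gives density.

For a generic shift, the finite data deciding an r-patch are locally constant in the internal space.
Density of L⋆ then gives local indistinguishability, and compactness of Ω gives repetitivity. The
statement about ΣKol(3,1) is the case of shift 0.

The boundaries are null by a Perron–Frobenius argument. Their areas satisfy a system of inequalities
for which (α² - α, α, 1) is a positive left eigenvector, which forces equality. So β∂Ω_A lies in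
∂Ω_A up to a null set, and hence so does every βⁿ∂Ω_A, although for large n this set lies in the
interior of Ω_A around 0 (`volume_frontier_window`). -/

namespace Kol

open Set MeasureTheory TopologicalSpace Letter
open scoped NNReal ENNReal

/-! ### Coordinates -/

/-- The element `a + b x + c x²` with integer coordinates `(a, b, c)`. -/
def evalAt {R : Type*} [CommRing R] (x : R) : ℤ × ℤ × ℤ →+ R where
  toFun t := t.1 + t.2.1 * x + t.2.2 * x ^ 2
  map_zero' := by simp
  map_add' s t := by simp only [Prod.fst_add, Prod.snd_add, Int.cast_add]; ring

theorem evalAt_apply {R : Type*} [CommRing R] (x : R) (t : ℤ × ℤ × ℤ) :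
    evalAt x t = t.1 + t.2.1 * x + t.2.2 * x ^ 2 := rfl

/-- Multiplication by a root of `x³ - 2x² - 1`, in coordinates. -/
def shift (t : ℤ × ℤ × ℤ) : ℤ × ℤ × ℤ := (t.2.2, t.1, t.2.1 + 2 * t.2.2)

/-- Division by a root of `x³ - 2x² - 1`, in coordinates. -/
def unshift (t : ℤ × ℤ × ℤ) : ℤ × ℤ × ℤ := (t.2.1, t.2.2 - 2 * t.1, t.1)

theorem shift_unshift (t : ℤ × ℤ × ℤ) : shift (unshift t) = t := by
  simp [shift, unshift]

theorem shift_add (s t : ℤ × ℤ × ℤ) : shift (s + t) = shift s + shift t := by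
  ext <;> simp [shift]
  ring

theorem shift_sub (s t : ℤ × ℤ × ℤ) : shift (s - t) = shift s - shift t := by
  ext <;> simp [shift]
  ring

theorem evalAt_shift {R : Type*} [CommRing R] {x : R} (hx : x ^ 3 - 2 * x ^ 2 - 1 = 0)
    (t : ℤ × ℤ × ℤ) : evalAt x (shift t) = x * evalAt x t := by
  simp only [evalAt_apply, shift, Int.cast_add, Int.cast_mul, Int.cast_ofNat]
  linear_combination -(t.2.2 : R) * hx

/-- The coordinates of the bond lengths. -/
def bondCoord : Letter → ℤ × ℤ × ℤ
  | A => (0, -1, 1)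
  | B => (0, 1, 0)
  | C => (1, 0, 0)

theorem evalAt_bondCoord {R : Type*} [CommRing R] (x : R) (i : Letter) :
    evalAt x (bondCoord i) = bond x i := by
  cases i <;> simp [evalAt_apply, bondCoord, bond]
  ring

/-- The coordinates of the length of a word. -/
def wordCoord (w : List Letter) : ℤ × ℤ × ℤ := (w.map bondCoord).sum

@[simp] theorem wordCoord_nil : wordCoord [] = 0 := rfl

@[simp] theorem wordCoord_cons (i : Letter) (w : List Letter) :
    wordCoord (i :: w) = bondCoord i + wordCoord w := by simp [wordCoord]

@[simp] theorem wordCoord_append (v w : List Letter) :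
    wordCoord (v ++ w) = wordCoord v + wordCoord w := by simp [wordCoord]

theorem evalAt_wordCoord (α : ℝ) (w : List Letter) :
    evalAt α (wordCoord w) = wordLength α w := by
  induction w with
  | nil => simp [wordLength]
  | cons i w ih => simp [wordLength, evalAt_bondCoord, ih]

/-! ### The substitution -/

theorem substWord_append (v w : List Letter) :
    substWord (v ++ w) = substWord v ++ substWord w := by simp [substWord]

theorem substWord_cons (i : Letter) (w : List Letter) :
    substWord (i :: w) = subst i ++ substWord w := by simp [substWord]

theorem iterate_substWord_append (n : ℕ) (v w : List Letter) :
    substWord^[n] (v ++ w) = substWord^[n] v ++ substWord^[n] w := by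
  induction n generalizing v w with
  | zero => rfl
  | succ n ih => simp [substWord_append, ih]

theorem wordCoord_substWord (w : List Letter) :
    wordCoord (substWord w) = shift (wordCoord w) := by
  induction w with
  | nil => rfl
  | cons i w ih =>
    rw [substWord_cons, wordCoord_append, ih, wordCoord_cons, shift_add]
    congr 1
    cases i <;> rfl

/-- The pairs `(i, d)` such that the inflation of a tile of type `i` contains a tile of type `j`
at distance `d` from its left endpoint. -/
def parents : Letter → List (Letter × ℤ × ℤ × ℤ)
  | A => [(A, 0), (B, 0)]
  | B => [(A, (0, -1, 1)), (B, (0, -1, 1)), (C, 0)]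
  | C => [(A, (0, 0, 1))]

theorem exists_subst_eq_of_mem_parents {i j : Letter} {d : ℤ × ℤ × ℤ}
    (h : (i, d) ∈ parents j) : ∃ p q, subst i = p ++ j :: q ∧ wordCoord p = d := by
  cases j <;> simp only [parents, List.mem_cons, Prod.mk.injEq, List.not_mem_nil, or_false] at h
  · rcases h with ⟨rfl, rfl⟩ | ⟨rfl, rfl⟩
    · exact ⟨[], [B, C], rfl, rfl⟩
    · exact ⟨[], [B], rfl, rfl⟩
  · rcases h with ⟨rfl, rfl⟩ | ⟨rfl, rfl⟩ | ⟨rfl, rfl⟩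
    · exact ⟨[A], [C], rfl, rfl⟩
    · exact ⟨[A], [], rfl, rfl⟩
    · exact ⟨[], [], rfl, rfl⟩
  · obtain ⟨rfl, rfl⟩ := h
    exact ⟨[A, B], [], rfl, rfl⟩

theorem mem_parents_of_subst_eq {i j : Letter} {p q : List Letter} (h : subst i = p ++ j :: q) :
    (i, wordCoord p) ∈ parents j := by
  cases i <;> rcases p with _ | ⟨a, _ | ⟨b, _ | ⟨c, p⟩⟩⟩ <;> simp [subst] at h <;>
    (try obtain ⟨rfl, h⟩ := h) <;> (try obtain ⟨rfl, h⟩ := h) <;> (try obtain ⟨rfl, h⟩ := h) <;>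
    (try subst h) <;> decide

/-- Desubstitution: a marked letter of an inflated word comes from one marked letter of the
original. This yields the induction principle for tile positions. -/
theorem exists_of_substWord_eq {w u v : List Letter} {j : Letter}
    (h : substWord w = u ++ j :: v) :
    ∃ u' i v' p q, w = u' ++ i :: v' ∧ subst i = p ++ j :: q ∧ u = substWord u' ++ p := by
  induction w generalizing u with
  | nil => simp [substWord] at h
  | cons a w ih =>
    rw [substWord_cons, List.append_eq_append_iff] at h
    rcases h with ⟨u₁, rfl, h⟩ | ⟨q, hq, h⟩
    · obtain ⟨u', i, v', p, q, rfl, hi, rfl⟩ := ih h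
      exact ⟨a :: u', i, v', p, q, rfl, hi, by simp [substWord_cons]⟩
    -- If `q` is empty, the marked letter starts the image of a later letter, so the recursion
    -- continues with an empty prefix.
    · rcases q with _ | ⟨b, q⟩
      · obtain ⟨u', i, v', p, q, rfl, hi, h'⟩ := ih (u := []) h.symm
        refine ⟨a :: u', i, v', p, q, rfl, hi, ?_⟩
        rw [substWord_cons, List.append_assoc, ← h', hq]
        simp
      · simp only [List.cons_append, List.cons.injEq] at h
        obtain ⟨rfl, rfl⟩ := h
        exact ⟨[], a, w, u, q, rfl, hq, by simp [substWord]⟩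

/-! ### Tile positions in coordinates -/

/-- The coordinates of the left endpoints of the tiles of type `i`, read off from the words
`σⁿ(B)|σⁿ(A)` with the seam at the origin. -/
def positions (i : Letter) : Set (ℤ × ℤ × ℤ) :=
  {t | ∃ (n : ℕ) (u v : List Letter), substWord^[n] [B, A] = u ++ i :: v ∧
    t = wordCoord u - wordCoord (substWord^[n] [B])}

theorem endpoints_eq_image (α : ℝ) (i : Letter) :
    endpoints α i = evalAt α '' positions i := by
  have hn (n : ℕ) : substWord^[n] [B, A] = substWord^[n] [B] ++ substWord^[n] [A] :=
    iterate_substWord_append n [B] [A]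
  ext x
  constructor
  · rintro (⟨n, u, v, h, rfl⟩ | ⟨n, u, v, h, rfl⟩)
    · refine ⟨wordCoord u, ⟨n, substWord^[n] [B] ++ u, v, by simp [hn, h], by simp⟩,
        evalAt_wordCoord α u⟩
    · refine ⟨-wordCoord (i :: v), ⟨n, u, v ++ substWord^[n] [A], by simp [hn, h], ?_⟩, ?_⟩
      · rw [h, wordCoord_append]; abel
      · rw [map_neg, evalAt_wordCoord]
  · rintro ⟨_, ⟨n, u, v, h, rfl⟩, rfl⟩
    rw [hn, List.append_eq_append_iff] at h
    rcases h with ⟨u', rfl, h⟩ | ⟨q, hq, h⟩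
    · left
      exact ⟨n, u', v, h, by simp [evalAt_wordCoord]⟩
    · rcases q with _ | ⟨a, q⟩
      · left
        refine ⟨n, [], v, h.symm, ?_⟩
        rw [hq, List.append_nil, sub_self, map_zero]
        rfl
      · simp only [List.cons_append, List.cons.injEq] at h
        obtain ⟨rfl, rfl⟩ := h
        right
        refine ⟨n, u, q, hq, ?_⟩
        rw [hq, wordCoord_append, sub_add_cancel_left, map_neg, evalAt_wordCoord]

theorem zero_mem_positions : (0 : ℤ × ℤ × ℤ) ∈ positions A :=
  ⟨0, [B], [], rfl, rfl⟩

theorem neg_bond_mem_positions : ((0, -1, 0) : ℤ × ℤ × ℤ) ∈ positions B :=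
  ⟨0, [], [A], rfl, rfl⟩

theorem shift_add_mem_positions {i j : Letter} {d t : ℤ × ℤ × ℤ} (h : (i, d) ∈ parents j)
    (ht : t ∈ positions i) : shift t + d ∈ positions j := by
  obtain ⟨n, u, v, hw, rfl⟩ := ht
  obtain ⟨p, q, hs, rfl⟩ := exists_subst_eq_of_mem_parents h
  refine ⟨n + 1, substWord u ++ p, q ++ substWord v, ?_, ?_⟩
  · rw [Function.iterate_succ_apply', hw, substWord_append, substWord_cons, hs]
    simp
  · rw [Function.iterate_succ_apply', wordCoord_append, wordCoord_substWord, wordCoord_substWord,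
      shift_sub]
    abel

/-- Every property that holds at the two tiles adjacent to the seam and that is inherited under
inflation holds at all tiles. -/
theorem positions_induction {P : Letter → ℤ × ℤ × ℤ → Prop} (hA : P A 0) (hB : P B (0, -1, 0))
    (hP : ∀ i j d t, (i, d) ∈ parents j → P i t → P j (shift t + d))
    {j : Letter} {t : ℤ × ℤ × ℤ} (ht : t ∈ positions j) : P j t := by
  obtain ⟨n, u, v, h, rfl⟩ := ht
  induction n generalizing j u v with
  | zero =>
    rcases u with _ | ⟨a, _ | ⟨b, u⟩⟩ <;> simp at h
    · obtain ⟨rfl, rfl⟩ := h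
      exact hB
    · obtain ⟨rfl, rfl, rfl⟩ := h
      exact hA
  | succ n ih =>
    rw [Function.iterate_succ_apply'] at h
    obtain ⟨u', i, v', p, q, hw, hs, rfl⟩ := exists_of_substWord_eq h
    have := hP i j _ _ (mem_parents_of_subst_eq hs) (ih u' v' hw)
    convert this using 1
    rw [Function.iterate_succ_apply', wordCoord_append, wordCoord_substWord, wordCoord_substWord,
      shift_sub]
    abel

/-- Since σ(BA) = A·BA·BC, the iterates are nested. The extra prefix is exactly the growth of the
part left of the seam, so the positions agree. -/
theorem exists_iterate_eq_append {n m : ℕ} (h : n ≤ m) :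
    ∃ p q, substWord^[m] [B, A] = p ++ substWord^[n] [B, A] ++ q ∧
      wordCoord p = wordCoord (substWord^[m] [B]) - wordCoord (substWord^[n] [B]) := by
  induction m, h using Nat.le_induction with
  | base => exact ⟨[], [], by simp, by simp⟩
  | succ m _ ih =>
    obtain ⟨p, q, hw, hp⟩ := ih
    have h1 : substWord [B, A] = [A] ++ [B, A] ++ [B, C] := rfl
    have h2 : substWord [B] = [A] ++ [B] := rfl
    refine ⟨substWord^[m] [A] ++ p, q ++ substWord^[m] [B, C], ?_, ?_⟩
    · rw [Function.iterate_succ_apply, h1, iterate_substWord_append, iterate_substWord_append, hw]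
      simp
    · rw [Function.iterate_succ_apply, h2, iterate_substWord_append, wordCoord_append,
        wordCoord_append, hp]
      abel

/-- Two tiles occur in a common word, measured from a common origin. -/
theorem exists_common_word {i j : Letter} {s t : ℤ × ℤ × ℤ} (hs : s ∈ positions i)
    (ht : t ∈ positions j) : ∃ (w u v u' v' : List Letter) (o : ℤ × ℤ × ℤ),
      w = u ++ i :: v ∧ w = u' ++ j :: v' ∧ s = wordCoord u - o ∧ t = wordCoord u' - o := by
  have key {n m : ℕ} (hnm : n ≤ m) {k : Letter} {u v : List Letter}
      (h : substWord^[n] [B, A] = u ++ k :: v) : ∃ u' v', substWord^[m] [B, A] = u' ++ k :: v' ∧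
        wordCoord u - wordCoord (substWord^[n] [B]) =
          wordCoord u' - wordCoord (substWord^[m] [B]) := by
    obtain ⟨p, q, hw, hp⟩ := exists_iterate_eq_append hnm
    refine ⟨p ++ u, v ++ q, by rw [hw, h]; simp, ?_⟩
    rw [wordCoord_append, hp]
    abel
  obtain ⟨n, u, v, h, rfl⟩ := hs
  obtain ⟨m, u', v', h', rfl⟩ := ht
  obtain ⟨u₁, v₁, h₁, e₁⟩ := key (le_max_left n m) h
  obtain ⟨u₂, v₂, h₂, e₂⟩ := key (le_max_right n m) h'
  exact ⟨_, u₁, v₁, u₂, v₂, _, h₁, h₂, e₁, e₂⟩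

/-! ### The tiles cover the line without overlap -/

theorem root_bounds {α : ℝ} (hα : α ^ 3 - 2 * α ^ 2 - 1 = 0) : 2.205 < α ∧ α < 2.206 := by
  have h2 : 2 < α := by
    by_contra h
    nlinarith [sq_nonneg α, mul_nonneg (sq_nonneg α) (sub_nonneg.2 (not_lt.1 h))]
  constructor
  · by_contra h
    nlinarith [mul_nonneg (sq_nonneg α) (sub_nonneg.2 (not_lt.1 h))]
  · by_contra h
    nlinarith [mul_nonneg (sq_nonneg α) (sub_nonneg.2 (not_lt.1 h))]

theorem bond_ge_one {α : ℝ} (h : 2 < α) (i : Letter) : 1 ≤ bond α i := by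
  cases i <;> simp only [bond] <;> nlinarith

theorem bond_le {α : ℝ} (h : 2 < α) (i : Letter) : bond α i ≤ α ^ 2 := by
  cases i <;> simp only [bond] <;> nlinarith

theorem wordLength_nonneg {α : ℝ} (h : 2 < α) (w : List Letter) : 0 ≤ wordLength α w := by
  apply List.sum_nonneg
  intro x hx
  obtain ⟨i, -, rfl⟩ := List.mem_map.1 hx
  linarith [bond_ge_one h i]

/-- Distinct tiles do not overlap. -/
theorem tile_unique {α : ℝ} (hα : 2 < α) {i j : Letter} {s t : ℤ × ℤ × ℤ}
    (hs : s ∈ positions i) (ht : t ∈ positions j) (h₁ : evalAt α s ≤ evalAt α t)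
    (h₂ : evalAt α t < evalAt α s + bond α i) : s = t ∧ i = j := by
  obtain ⟨w, u, v, u', v', o, hw, hw', rfl, rfl⟩ := exists_common_word hs ht
  rw [map_sub, map_sub, evalAt_wordCoord, evalAt_wordCoord] at h₁ h₂
  rw [hw, List.append_eq_append_iff] at hw'
  have happ (a b : List Letter) : wordLength α (a ++ b) = wordLength α a + wordLength α b := by
    simp [wordLength]
  have hcons (a : Letter) (b : List Letter) : wordLength α (a :: b) = bond α a + wordLength α b := by
    simp [wordLength]
  rcases hw' with ⟨_ | ⟨a, q⟩, rfl, h⟩ | ⟨_ | ⟨a, q⟩, rfl, h⟩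
  · simp at h ⊢
    exact h.1
  · simp only [List.cons_append, List.cons.injEq] at h
    obtain ⟨rfl, rfl⟩ := h
    rw [happ, hcons] at h₂
    linarith [wordLength_nonneg hα q]
  · simp at h ⊢
    exact h.1.symm
  · rw [happ, hcons] at h₁
    linarith [wordLength_nonneg hα q, bond_ge_one hα a]

theorem exists_tile_of_lt_wordLength {α : ℝ} (w : List Letter) {y : ℝ} (h0 : 0 ≤ y)
    (hy : y < wordLength α w) : ∃ u i v, w = u ++ i :: v ∧ wordLength α u ≤ y ∧
      y < wordLength α u + bond α i := by
  induction w generalizing y with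
  | nil => simp [wordLength] at hy; linarith
  | cons a w ih =>
    have hcons (a : Letter) (b : List Letter) :
      wordLength α (a :: b) = bond α a + wordLength α b := by simp [wordLength]
    rw [hcons] at hy
    by_cases h : y < bond α a
    · exact ⟨[], a, w, rfl, by simpa [wordLength] using h0, by simpa [wordLength] using h⟩
    · obtain ⟨u, i, v, rfl, h1, h2⟩ := ih (y := y - bond α a) (by linarith) (by linarith)
      refine ⟨a :: u, i, v, rfl, ?_, ?_⟩ <;> rw [hcons] <;> linarith

/-- The tiles cover the line. -/
theorem exists_tile {α : ℝ} (hα : α ^ 3 - 2 * α ^ 2 - 1 = 0) (y : ℝ) :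
    ∃ i, ∃ t ∈ positions i, evalAt α t ≤ y ∧ y < evalAt α t + bond α i := by
  have h2 : 2 < α := by linarith [(root_bounds hα).1]
  have hlen (n : ℕ) (w : List Letter) :
      wordLength α (substWord^[n] w) = α ^ n * wordLength α w := by
    induction n with
    | zero => simp
    | succ n ih =>
      rw [Function.iterate_succ_apply', ← evalAt_wordCoord, wordCoord_substWord, evalAt_shift hα,
        evalAt_wordCoord, ih]
      ring
  obtain ⟨n, hn⟩ := pow_unbounded_of_one_lt |y| (by linarith : 1 < α)
  have hB : wordLength α [B] = α := by simp [wordLength, bond]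
  have hBA : wordLength α [B, A] = α ^ 2 := by simp [wordLength, bond]
  have hp : 0 < α ^ n := by positivity
  -- The left half has length αⁿ·α and the right half αⁿ(α² - α); both exceed |y|.
  obtain ⟨u, i, v, hw, h1, h3⟩ := exists_tile_of_lt_wordLength (α := α)
    (substWord^[n] [B, A]) (y := y + α ^ n * α)
    (by nlinarith [neg_abs_le y]) (by rw [hlen, hBA]; nlinarith [le_abs_self y])
  refine ⟨i, _, ⟨n, u, v, hw, rfl⟩, ?_⟩
  rw [map_sub, evalAt_wordCoord, evalAt_wordCoord, hlen, hB]
  constructor <;> linarith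

/-! ### The conjugate root and the coordinates -/

theorem re_and_normSq_of_root {α : ℝ} (hα : α ^ 3 - 2 * α ^ 2 - 1 = 0) {β : ℂ}
    (hβ : β ^ 3 - 2 * β ^ 2 - 1 = 0) (him : β.im ≠ 0) :
    β.re = (2 - α) / 2 ∧ β.re ^ 2 + β.im ^ 2 = α ^ 2 - 2 * α := by
  have hne : β - α ≠ 0 := by
    intro h
    apply him
    rw [sub_eq_zero.1 h, Complex.ofReal_im]
  have hα' : (α : ℂ) ^ 3 - 2 * (α : ℂ) ^ 2 - 1 = 0 := by exact_mod_cast hα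
  -- The quadratic cofactor of x - α; its coefficients give the trace and the norm of β over ℝ.
  have h : β ^ 2 + (α - 2) * β + (α ^ 2 - 2 * α) = 0 := by
    apply mul_left_cancel₀ hne
    linear_combination hβ - hα'
  have hre := congrArg Complex.re h
  have hi := congrArg Complex.im h
  simp [pow_two] at hre hi
  have h1 : β.re = (2 - α) / 2 := by
    apply mul_left_cancel₀ him
    linear_combination hi / 2
  exact ⟨h1, by linear_combination -hre + 2 * β.re * h1⟩

theorem norm_sq_of_root {α : ℝ} (hα : α ^ 3 - 2 * α ^ 2 - 1 = 0) {β : ℂ}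
    (hβ : β ^ 3 - 2 * β ^ 2 - 1 = 0) (him : β.im ≠ 0) : ‖β‖ ^ 2 = α ^ 2 - 2 * α := by
  rw [Complex.sq_norm, Complex.normSq_apply, ← (re_and_normSq_of_root hα hβ him).2]
  ring

theorem ne_zero_of_root {β : ℂ} (hβ : β ^ 3 - 2 * β ^ 2 - 1 = 0) : β ≠ 0 := by
  rintro rfl
  norm_num at hβ

/-- The coordinates of a lattice point, expressed by its two projections. -/
theorem coord_formula {α : ℝ} (hα : α ^ 3 - 2 * α ^ 2 - 1 = 0) {β : ℂ}
    (hβ : β ^ 3 - 2 * β ^ 2 - 1 = 0) (him : β.im ≠ 0) (t : ℤ × ℤ × ℤ) :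
    ∃ s : ℝ, |s| ≤ 1.51 * ‖evalAt β t‖ ∧
      (3 * α ^ 2 - 4 * α) * t.2.2 = evalAt α t - (evalAt β t).re - s * ((3 * α - 2) / 2) ∧
      t.2.1 = s - (2 - α) * t.2.2 ∧
      t.1 = (evalAt β t).re - (2 - α) / 2 * s + (α ^ 2 - 2 * α) * t.2.2 := by
  obtain ⟨hp, hn⟩ := re_and_normSq_of_root hα hβ him
  obtain ⟨hl, hu⟩ := root_bounds hα
  have hzi : (evalAt β t).im = β.im * (t.2.1 + (2 - α) * t.2.2) := by
    simp [evalAt_apply, pow_two]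
    linear_combination (2 * (t.2.2 : ℝ) * β.im) * hp
  have hzr : (evalAt β t).re = t.1 + t.2.1 * β.re + t.2.2 * (β.re ^ 2 - β.im ^ 2) := by
    simp [evalAt_apply, pow_two]
  -- The witness is Im z / Im β for z the internal part; |Im β| ≥ 0.664 and 1/0.664 < 1.51.
  refine ⟨t.2.1 + (2 - α) * t.2.2, ?_, ?_, by ring, ?_⟩
  · have h1 : |β.im| * |(t.2.1 : ℝ) + (2 - α) * t.2.2| ≤ ‖evalAt β t‖ := by
      rw [← abs_mul, ← hzi]
      exact Complex.abs_im_le_norm _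
    have h2 : 0.664 ≤ |β.im| := by
      apply le_of_sq_le_sq _ (abs_nonneg _)
      rw [sq_abs]
      nlinarith
    have h3 := abs_nonneg ((t.2.1 : ℝ) + (2 - α) * t.2.2)
    nlinarith
  · rw [hzr, evalAt_apply, hp]
    rw [hp] at hn
    linear_combination (-t.2.2 : ℝ) * hn
  · rw [hzr, hp]
    rw [hp] at hn
    linear_combination (t.2.2 : ℝ) * hn

theorem abs_coord_le {α : ℝ} (hα : α ^ 3 - 2 * α ^ 2 - 1 = 0) {β : ℂ}
    (hβ : β ^ 3 - 2 * β ^ 2 - 1 = 0) (him : β.im ≠ 0) (t : ℤ × ℤ × ℤ) :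
    |(t.1 : ℝ)| ≤ 2 * (|evalAt α t| + ‖evalAt β t‖) ∧
    |(t.2.1 : ℝ)| ≤ 2 * (|evalAt α t| + ‖evalAt β t‖) ∧
    |(t.2.2 : ℝ)| ≤ |evalAt α t| + ‖evalAt β t‖ := by
  obtain ⟨s, hs, hc, hb, ha⟩ := coord_formula hα hβ him t
  obtain ⟨hl, hu⟩ := root_bounds hα
  have hr := abs_le.1 (Complex.abs_re_le_norm (evalAt β t))
  have hx := abs_le.1 (le_refl |evalAt α t|)
  have hx0 := abs_nonneg (evalAt α t)
  have hz0 := norm_nonneg (evalAt β t)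
  set x := evalAt α t
  set z := evalAt β t
  have hs' : |s * ((3 * α - 2) / 2)| ≤ 3.5 * ‖z‖ := by
    rw [abs_mul, abs_of_pos (by linarith : 0 < (3 * α - 2) / 2)]
    nlinarith [abs_nonneg s]
  have hD : 5.7 ≤ 3 * α ^ 2 - 4 * α := by nlinarith
  have hc' : |(t.2.2 : ℝ)| ≤ 0.2 * |x| + 0.8 * ‖z‖ := by
    have h1 : (3 * α ^ 2 - 4 * α) * |(t.2.2 : ℝ)| ≤ |x| + ‖z‖ + 3.5 * ‖z‖ := by
      rw [← abs_of_pos (by linarith : 0 < 3 * α ^ 2 - 4 * α), ← abs_mul, hc]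
      have := abs_le.1 hs'
      rw [abs_le]
      constructor <;> linarith
    nlinarith [abs_nonneg (t.2.2 : ℝ)]
  have hs2 := abs_le.1 hs
  have h4 : |(2 - α) * (t.2.2 : ℝ)| ≤ 0.3 * |(t.2.2 : ℝ)| := by
    rw [abs_mul]
    gcongr
    rw [abs_le]; constructor <;> linarith
  have h5 : |(2 - α) / 2 * s| ≤ 0.3 * |s| := by
    rw [abs_mul]
    gcongr
    rw [abs_le]; constructor <;> linarith
  have h6 : |(α ^ 2 - 2 * α) * (t.2.2 : ℝ)| ≤ 0.5 * |(t.2.2 : ℝ)| := by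
    rw [abs_mul]
    gcongr
    rw [abs_le]; constructor <;> nlinarith
  have h4' := abs_le.1 h4
  have h5' := abs_le.1 h5
  have h6' := abs_le.1 h6
  refine ⟨?_, ?_, by linarith⟩
  · rw [ha, abs_le]; constructor <;> linarith
  · rw [hb, abs_le]; constructor <;> linarith

/-- Only finitely many lattice points have bounded projections. -/
theorem finite_coord {α : ℝ} (hα : α ^ 3 - 2 * α ^ 2 - 1 = 0) {β : ℂ}
    (hβ : β ^ 3 - 2 * β ^ 2 - 1 = 0) (him : β.im ≠ 0) (r r' : ℝ) :
    {t : ℤ × ℤ × ℤ | |evalAt α t| ≤ r ∧ ‖evalAt β t‖ ≤ r'}.Finite := by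
  obtain ⟨N, hN⟩ := exists_nat_ge (2 * (r + r'))
  refine ((finite_Icc (-N : ℤ) N).prod ((finite_Icc (-N : ℤ) N).prod
    (finite_Icc (-N : ℤ) N))).subset ?_
  rintro t ⟨h1, h2⟩
  obtain ⟨ha, hb, hc⟩ := abs_coord_le hα hβ him t
  have key (k : ℤ) (hk : |(k : ℝ)| ≤ N) : k ∈ Icc (-N : ℤ) N := by
    rw [mem_Icc, ← abs_le]
    exact_mod_cast hk
  have := abs_nonneg (evalAt α t)
  have := norm_nonneg (evalAt β t)
  exact ⟨key _ (by linarith), key _ (by linarith), key _ (by linarith)⟩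

/-- Coordinates are determined by the real projection. -/
theorem evalAt_injective {α : ℝ} (hα : α ^ 3 - 2 * α ^ 2 - 1 = 0) {β : ℂ}
    (hβ : β ^ 3 - 2 * β ^ 2 - 1 = 0) (him : β.im ≠ 0) : Function.Injective (evalAt α) := by
  rw [injective_iff_map_eq_zero]
  intro t ht
  -- A kernel element can be multiplied by the root: its physical part stays 0 while its conjugate
  -- tends to 0. All integer coordinates then fall below 1 in modulus, and multiplication is
  -- injective.
  have hshift (n : ℕ) : evalAt α (shift^[n] t) = 0 ∧
      evalAt β (shift^[n] t) = β ^ n * evalAt β t := by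
    induction n with
    | zero => simp [ht]
    | succ n ih =>
      rw [Function.iterate_succ_apply', evalAt_shift hα, evalAt_shift hβ, ih.1, ih.2]
      exact ⟨mul_zero _, by ring⟩
  have hlim : Filter.Tendsto (fun n : ℕ => ‖β ^ n * evalAt β t‖) Filter.atTop (nhds 0) := by
    have := ((tendsto_pow_atTop_nhds_zero_of_norm_lt_one (norm_lt_one_of_root hβ him)).mul_const
      (evalAt β t)).norm
    simpa using this
  obtain ⟨n, hn⟩ := (hlim.eventually (gt_mem_nhds (by norm_num : (0 : ℝ) < 1 / 4))).exists
  obtain ⟨ha, hb, hc⟩ := abs_coord_le hα hβ him (shift^[n] t)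
  rw [(hshift n).1, (hshift n).2, abs_zero] at ha hb hc
  have key (k : ℤ) (hk : |(k : ℝ)| < 1) : k = 0 := by
    rw [← Int.abs_lt_one_iff]
    exact_mod_cast hk
  have h0 : shift^[n] t = 0 := by
    ext
    · exact key _ (by linarith)
    · exact key _ (by linarith)
    · exact key _ (by linarith)
  have hinj : Function.Injective shift := by
    intro s t h
    simp only [shift, Prod.mk.injEq] at h
    obtain ⟨h1, h2, h3⟩ := h
    ext
    · exact h2
    · linarith
    · exact h1
  apply hinj.iterate n
  rw [h0]
  exact (Function.iterate_fixed (x := (0 : ℤ × ℤ × ℤ)) rfl n).symm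

/-! ### The windows -/

theorem mem_window_iff {β : ℂ} (hβ : ‖β‖ < 1) {j : Letter} {z : ℂ} :
    z ∈ window β j ↔ ∃ i d, (i, d) ∈ parents j ∧ ∃ z' ∈ window β i, β * z' + evalAt β d = z := by
  have h := isWindowSystem_window hβ
  have e : evalAt β (0, -1, 1) = β ^ 2 - β := by simp [evalAt_apply]; ring
  have e' : evalAt β (0, 0, 1) = β ^ 2 := by simp [evalAt_apply]
  constructor
  · intro hz
    cases j
    · rw [h.eq_A] at hz
      rcases hz with ⟨z', hz', rfl⟩ | ⟨z', hz', rfl⟩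
      · exact ⟨A, 0, by simp [parents], z', hz', by simp⟩
      · exact ⟨B, 0, by simp [parents], z', hz', by simp⟩
    · rw [h.eq_B] at hz
      rcases hz with (⟨z', hz', rfl⟩ | ⟨z', hz', rfl⟩) | ⟨z', hz', rfl⟩
      · exact ⟨A, (0, -1, 1), by simp [parents], z', hz', by rw [e]⟩
      · exact ⟨B, (0, -1, 1), by simp [parents], z', hz', by rw [e]⟩
      · exact ⟨C, 0, by simp [parents], z', hz', by simp⟩
    · rw [h.eq_C] at hz
      obtain ⟨z', hz', rfl⟩ := hz
      exact ⟨A, (0, 0, 1), by simp [parents], z', hz', by rw [e']⟩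
  · rintro ⟨i, d, hid, z', hz', rfl⟩
    cases j <;>
      simp only [parents, List.mem_cons, Prod.mk.injEq, List.not_mem_nil, or_false] at hid
    · rw [h.eq_A]
      rcases hid with ⟨rfl, rfl⟩ | ⟨rfl, rfl⟩
      · exact Or.inl ⟨z', hz', by simp⟩
      · exact Or.inr ⟨z', hz', by simp⟩
    · rw [h.eq_B]
      rcases hid with ⟨rfl, rfl⟩ | ⟨rfl, rfl⟩ | ⟨rfl, rfl⟩
      · exact Or.inl (Or.inl ⟨z', hz', by simp [e]⟩)
      · exact Or.inl (Or.inr ⟨z', hz', by simp [e]⟩)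
      · exact Or.inr ⟨z', hz', by simp⟩
    · rw [h.eq_C]
      obtain ⟨rfl, rfl⟩ := hid
      exact ⟨z', hz', by simp [e']⟩

theorem isCompact_window {β : ℂ} (hβ : ‖β‖ < 1) (i : Letter) : IsCompact (window β i) :=
  (isWindowSystem_window hβ).isCompact i

theorem isCompact_totalWindow {β : ℂ} (hβ : ‖β‖ < 1) : IsCompact (totalWindow β) :=
  isCompact_iUnion (isCompact_window hβ)

/-- A fixed point of one of the maps `z ↦ β z + d` of a window into itself lies in that window. -/
theorem fixedPoint_mem_window {β : ℂ} (hβ : ‖β‖ < 1) {i : Letter} {d : ℤ × ℤ × ℤ}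
    (h : (i, d) ∈ parents i) {z : ℂ} (hz : β * z + evalAt β d = z) : z ∈ window β i := by
  obtain ⟨w, hw⟩ := (isWindowSystem_window hβ).nonempty i
  have hmem (n : ℕ) : β ^ n * (w - z) + z ∈ window β i := by
    induction n with
    | zero => simpa using hw
    | succ n ih =>
      refine (mem_window_iff hβ).2 ⟨i, d, h, _, ih, ?_⟩
      rw [pow_succ]
      linear_combination hz
  refine (isCompact_window hβ i).isClosed.mem_of_tendsto (b := Filter.atTop) ?_ (Filter.Eventually.of_forall hmem)
  have := ((tendsto_pow_atTop_nhds_zero_of_norm_lt_one hβ).mul_const (w - z)).add_const z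
  simpa using this

theorem evalAt_mem_window {β : ℂ} (hβ : β ^ 3 - 2 * β ^ 2 - 1 = 0) (him : β.im ≠ 0)
    {i : Letter} {t : ℤ × ℤ × ℤ} (ht : t ∈ positions i) : evalAt β t ∈ window β i := by
  have h1 := norm_lt_one_of_root hβ him
  refine positions_induction (P := fun i t => evalAt β t ∈ window β i) ?_ ?_ ?_ ht
  · exact fixedPoint_mem_window h1 (d := 0) (by simp [parents]) (by simp)
  · refine fixedPoint_mem_window h1 (d := (0, -1, 1)) (by simp [parents]) ?_
    simp [evalAt_apply]
    ring
  · intro i j d t hid ht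
    rw [map_add, evalAt_shift hβ]
    exact (mem_window_iff h1).2 ⟨i, d, hid, _, ht, rfl⟩

/-- At a point of Ω of maximal modulus M, the recursion gives M ≤ 0.675 M + 0.876, and 0.876 / 0.325
< 2.7. -/
theorem norm_le_of_mem_window {α : ℝ} (hα : α ^ 3 - 2 * α ^ 2 - 1 = 0) {β : ℂ}
    (hβ : β ^ 3 - 2 * β ^ 2 - 1 = 0) (him : β.im ≠ 0) {i : Letter} {z : ℂ}
    (hz : z ∈ window β i) : ‖z‖ ≤ 2.7 := by
  have h1 := norm_lt_one_of_root hβ him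
  obtain ⟨hl, hu⟩ := root_bounds hα
  have hn := norm_sq_of_root hα hβ him
  have hb : ‖β‖ ≤ 0.675 := by nlinarith [norm_nonneg β]
  have hd : ‖β ^ 2 - β‖ ≤ 0.876 := by
    have h2 : ‖β - 1‖ ^ 2 ≤ 1.297 ^ 2 := by
      obtain ⟨hp, hn⟩ := re_and_normSq_of_root hα hβ him
      rw [Complex.sq_norm, Complex.normSq_apply]
      simp
      nlinarith
    have h3 : ‖β - 1‖ ≤ 1.297 := le_of_sq_le_sq h2 (by norm_num)
    rw [show β ^ 2 - β = β * (β - 1) by ring, norm_mul]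
    nlinarith [norm_nonneg β, norm_nonneg (β - 1)]
  have hd' : ‖β ^ 2‖ ≤ 0.876 := by rw [norm_pow]; nlinarith
  obtain ⟨w, hw, hmax⟩ := (isCompact_totalWindow h1).exists_isMaxOn ⟨z, mem_iUnion.2 ⟨i, hz⟩⟩
    continuous_norm.continuousOn
  obtain ⟨j, hj⟩ := mem_iUnion.1 hw
  obtain ⟨k, d, hkd, w', hw', rfl⟩ := (mem_window_iff h1).1 hj
  have hmax' : ‖w'‖ ≤ ‖β * w' + evalAt β d‖ := hmax (mem_iUnion.2 ⟨k, hw'⟩)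
  have hz' : ‖z‖ ≤ ‖β * w' + evalAt β d‖ := hmax (mem_iUnion.2 ⟨i, hz⟩)
  have hdd : ‖evalAt β d‖ ≤ 0.876 := by
    cases j <;>
      simp only [parents, List.mem_cons, Prod.mk.injEq, List.not_mem_nil, or_false] at hkd
    · rcases hkd with ⟨-, rfl⟩ | ⟨-, rfl⟩ <;> simp <;> norm_num
    · rcases hkd with ⟨-, rfl⟩ | ⟨-, rfl⟩ | ⟨-, rfl⟩
      · simpa [evalAt_apply, neg_add_eq_sub] using hd
      · simpa [evalAt_apply, neg_add_eq_sub] using hd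
      · simp; norm_num
    · obtain ⟨-, rfl⟩ := hkd
      simpa [evalAt_apply] using hd'
  have h4 : ‖β * w' + evalAt β d‖ ≤ 0.675 * ‖β * w' + evalAt β d‖ + 0.876 := by
    calc ‖β * w' + evalAt β d‖ ≤ ‖β‖ * ‖w'‖ + ‖evalAt β d‖ := by
          rw [← norm_mul]; exact norm_add_le _ _
      _ ≤ _ := by gcongr
  linarith

/-! ### Every lattice point in a window is a tile position -/

/-- `t` is bounded and is not one of the two tiles adjacent to the seam. -/
def isCandidate (j : Letter) (t : ℤ × ℤ × ℤ) : Bool :=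
  (decide (-4 ≤ t.1) && decide (t.1 ≤ 4) && decide (-4 ≤ t.2.1) && decide (t.2.1 ≤ 4) &&
    decide (-2 ≤ t.2.2) && decide (t.2.2 ≤ 2)) &&
  !(decide (j = A) && decide (t = (0, 0, 0))) && !(decide (j = B) && decide (t = (0, -1, 0)))

/-- `(j, t)` is the beginning of a chain of `n` candidates, each a possible parent of the one
before. -/
def hasAncestors : ℕ → Letter → ℤ × ℤ × ℤ → Bool
  | 0, _, _ => true
  | n + 1, j, t => isCandidate j t &&
      (parents j).any fun e => hasAncestors n e.1 (unshift (t - e.2))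

/-- A finite search: no chain of 13 candidates exists. The two seam tiles must be barred from being
candidates because each is its own parent and would give arbitrarily long chains. -/
theorem hasAncestors_eq_false : ∀ a ∈ Finset.Icc (-4 : ℤ) 4, ∀ b ∈ Finset.Icc (-4 : ℤ) 4,
    ∀ c ∈ Finset.Icc (-2 : ℤ) 2, ∀ j : Letter, hasAncestors 13 j (a, b, c) = false := by
  decide +kernel

theorem coord_mem_box {α : ℝ} (hα : α ^ 3 - 2 * α ^ 2 - 1 = 0) {β : ℂ}
    (hβ : β ^ 3 - 2 * β ^ 2 - 1 = 0) (him : β.im ≠ 0) {t : ℤ × ℤ × ℤ}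
    (hx : |evalAt α t| ≤ 5) (hz : ‖evalAt β t‖ ≤ 2.7) :
    (-4 ≤ t.1 ∧ t.1 ≤ 4) ∧ (-4 ≤ t.2.1 ∧ t.2.1 ≤ 4) ∧ -2 ≤ t.2.2 ∧ t.2.2 ≤ 2 := by
  obtain ⟨s, hs, hc, hb, ha⟩ := coord_formula hα hβ him t
  obtain ⟨hl, hu⟩ := root_bounds hα
  have hr := abs_le.1 ((Complex.abs_re_le_norm (evalAt β t)).trans hz)
  have hx' := abs_le.1 hx
  have hs' := abs_le.1 (hs.trans (by linarith : 1.51 * ‖evalAt β t‖ ≤ 4.077))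
  have key {k : ℤ} {m : ℕ} (h : |(k : ℝ)| < m + 1) : -(m : ℤ) ≤ k ∧ k ≤ m := by
    rw [← abs_le]
    exact Int.lt_add_one_iff.1 (by exact_mod_cast h)
  have hc' : -2 ≤ t.2.2 ∧ t.2.2 ≤ 2 := by
    refine key (m := 2) ?_
    have hD : 5.76 ≤ 3 * α ^ 2 - 4 * α := by nlinarith
    -- The bounds 5 and 2.7 leave little room here: 17.2 / 5.76 is just below 3.
    have h1 : (3 * α ^ 2 - 4 * α) * |(t.2.2 : ℝ)| ≤ 17.2 := by
      rw [← abs_of_pos (by linarith : 0 < 3 * α ^ 2 - 4 * α), ← abs_mul, hc, abs_le]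
      constructor <;> nlinarith
    push_cast
    nlinarith [abs_nonneg (t.2.2 : ℝ)]
  have hc2 : (-2 : ℝ) ≤ t.2.2 ∧ (t.2.2 : ℝ) ≤ 2 := by exact_mod_cast hc'
  refine ⟨key (m := 4) ?_, key (m := 4) ?_, hc'⟩
  · have h2 : 0 ≤ α ^ 2 - 2 * α := by nlinarith
    have h3 : α ^ 2 - 2 * α ≤ 0.46 := by nlinarith
    rw [ha, abs_lt]
    push_cast
    constructor <;> nlinarith
  · rw [hb, abs_lt]
    push_cast
    constructor <;> nlinarith

/-- Passing to a parent contracts the physical coordinate up to an offset of at most α² < 4.87. In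
particular the interval |x| ≤ 5 is mapped into itself, as (5 + 4.87) / 2.2 < 5. -/
theorem abs_evalAt_unshift_le {α : ℝ} (hα : α ^ 3 - 2 * α ^ 2 - 1 = 0) {i j : Letter}
    {d : ℤ × ℤ × ℤ} (hd : (i, d) ∈ parents j) (t : ℤ × ℤ × ℤ) :
    2.2 * |evalAt α (unshift (t - d))| ≤ |evalAt α t| + 4.87 := by
  obtain ⟨hl, hu⟩ := root_bounds hα
  have h1 : α * evalAt α (unshift (t - d)) = evalAt α t - evalAt α d := by
    rw [← evalAt_shift hα, shift_unshift, map_sub]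
  have h2 : |evalAt α d| ≤ 4.87 := by
    cases j <;>
      simp only [parents, List.mem_cons, Prod.mk.injEq, List.not_mem_nil, or_false] at hd
    · rcases hd with ⟨-, rfl⟩ | ⟨-, rfl⟩ <;> simp <;> norm_num
    · rcases hd with ⟨-, rfl⟩ | ⟨-, rfl⟩ | ⟨-, rfl⟩
      · simp [evalAt_apply, abs_le]; constructor <;> nlinarith
      · simp [evalAt_apply, abs_le]; constructor <;> nlinarith
      · simp; norm_num
    · obtain ⟨-, rfl⟩ := hd
      simp [evalAt_apply]
      nlinarith
  calc 2.2 * |evalAt α (unshift (t - d))| ≤ α * |evalAt α (unshift (t - d))| := by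
        gcongr; linarith
    _ = |evalAt α t - evalAt α d| := by
        rw [← h1, abs_mul, abs_of_pos (by linarith : 0 < α)]
    _ ≤ |evalAt α t| + |evalAt α d| := abs_sub _ _
    _ ≤ _ := by gcongr

/-- Descent along parents: a counterexample has a parent that is again a counterexample. Once |x| ≤
5, all further ancestors stay in the finite box and avoid the seam tiles, contradicting the search;
from larger |x| the contraction leads there. -/
theorem mem_positions_of_mem_window {α : ℝ} (hα : α ^ 3 - 2 * α ^ 2 - 1 = 0) {β : ℂ}
    (hβ : β ^ 3 - 2 * β ^ 2 - 1 = 0) (him : β.im ≠ 0) {j : Letter} {t : ℤ × ℤ × ℤ}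
    (ht : evalAt β t ∈ window β j) : t ∈ positions j := by
  have h1 := norm_lt_one_of_root hβ him
  have hne := ne_zero_of_root hβ
  have hparent {j : Letter} {t : ℤ × ℤ × ℤ} (ht : evalAt β t ∈ window β j)
      (hn : t ∉ positions j) : ∃ i d, (i, d) ∈ parents j ∧
        evalAt β (unshift (t - d)) ∈ window β i ∧ unshift (t - d) ∉ positions i := by
    obtain ⟨i, d, hid, z, hz, hzt⟩ := (mem_window_iff h1).1 ht
    refine ⟨i, d, hid, ?_, fun h => hn ?_⟩
    · convert hz
      apply mul_left_cancel₀ hne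
      rw [← evalAt_shift hβ, shift_unshift, map_sub, ← hzt]
      ring
    · have := shift_add_mem_positions hid h
      rwa [shift_unshift, sub_add_cancel] at this
  have hchain (n : ℕ) : ∀ {j : Letter} {t : ℤ × ℤ × ℤ}, evalAt β t ∈ window β j →
      t ∉ positions j → |evalAt α t| ≤ 5 → hasAncestors n j t = true := by
    induction n with
    | zero => intros; rfl
    | succ n ih =>
      intro j t ht hn hx
      obtain ⟨i, d, hid, hw, hn'⟩ := hparent ht hn
      have hbox := coord_mem_box hα hβ him hx (norm_le_of_mem_window hα hβ him ht)
      have hA : ¬ (j = A ∧ t = (0, 0, 0)) := by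
        rintro ⟨rfl, rfl⟩
        exact hn zero_mem_positions
      have hB : ¬ (j = B ∧ t = (0, -1, 0)) := by
        rintro ⟨rfl, rfl⟩
        exact hn neg_bond_mem_positions
      have hrec := ih hw hn' (by linarith [abs_evalAt_unshift_le hα hid t])
      simp only [hasAncestors, Bool.and_eq_true, List.any_eq_true]
      refine ⟨?_, (i, d), hid, hrec⟩
      simp only [isCandidate, ← Bool.decide_and, ← decide_not, decide_eq_true_eq]
      tauto
  -- Induction on the size of the physical coordinate: a counterexample with |x| ≤ N + 6 has a
  -- parent with |x| ≤ N + 5.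
  have hno (N : ℕ) : ∀ {j : Letter} {t : ℤ × ℤ × ℤ}, evalAt β t ∈ window β j →
      |evalAt α t| ≤ N + 5 → t ∈ positions j := by
    induction N with
    | zero =>
      intro j t ht hx
      by_contra hn
      rw [Nat.cast_zero, zero_add] at hx
      have h := hchain 13 ht hn hx
      obtain ⟨ha, hb, hc⟩ := coord_mem_box hα hβ him hx (norm_le_of_mem_window hα hβ him ht)
      rw [hasAncestors_eq_false t.1 (Finset.mem_Icc.2 ha) t.2.1 (Finset.mem_Icc.2 hb) t.2.2
        (Finset.mem_Icc.2 hc) j] at h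
      exact Bool.false_ne_true h
    | succ N ih =>
      intro j t ht hx
      by_contra hn
      obtain ⟨i, d, hid, hw, hn'⟩ := hparent ht hn
      refine hn' (ih hw ?_)
      have := abs_evalAt_unshift_le hα hid t
      push_cast at hx
      have hN : (0 : ℝ) ≤ N := N.cast_nonneg
      linarith
  obtain ⟨N, hN⟩ := exists_nat_ge |evalAt α t|
  exact hno N ht (by linarith)

/-! ### The lattice -/

theorem mem_lattice_iff {α : ℝ} {β : ℂ} {x : ℝ} {z : ℂ} :
    (x, z) ∈ lattice α β ↔ ∃ t, evalAt α t = x ∧ evalAt β t = z := by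
  constructor
  · intro h
    have hle : lattice α β ≤ ((evalAt α).prod (evalAt β)).range := by
      refine (AddSubgroup.closure_le _).2 ?_
      rintro _ ⟨i, rfl⟩
      exact ⟨bondCoord i, by simp [evalAt_bondCoord]⟩
    obtain ⟨t, ht⟩ := hle h
    rw [AddMonoidHom.prod_apply, Prod.mk.injEq] at ht
    exact ⟨t, ht⟩
  · rintro ⟨t, rfl, rfl⟩
    have hbond (i : Letter) : (bond α i, bond β i) ∈ lattice α β :=
      AddSubgroup.subset_closure ⟨i, rfl⟩
    -- Uses x² = (x² - x) + x, so the bond vectors generate the same group as the powers 1, x, x².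
    have h := add_mem (add_mem (zsmul_mem (hbond C) t.1) (zsmul_mem (hbond B) (t.2.1 + t.2.2)))
      (zsmul_mem (hbond A) t.2.2)
    convert h using 1
    ext1 <;> simp [evalAt_apply, bond] <;> ring

theorem snd_image_lattice (α : ℝ) (β : ℂ) :
    Prod.snd '' (lattice α β : Set (ℝ × ℂ)) = range (evalAt β) := by
  ext z
  constructor
  · rintro ⟨⟨x, z⟩, h, rfl⟩
    obtain ⟨t, -, ht⟩ := mem_lattice_iff.1 h
    exact ⟨t, ht⟩
  · rintro ⟨t, rfl⟩
    exact ⟨(evalAt α t, evalAt β t), mem_lattice_iff.2 ⟨t, rfl, rfl⟩, rfl⟩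

theorem mem_modelSet_iff {α : ℝ} {β : ℂ} {W : Set ℂ} {x : ℝ} :
    x ∈ modelSet (lattice α β) W ↔ ∃ t, evalAt α t = x ∧ evalAt β t ∈ W := by
  constructor
  · rintro ⟨z, hz, h⟩
    obtain ⟨t, ht, rfl⟩ := mem_lattice_iff.1 h
    exact ⟨t, ht, hz⟩
  · rintro ⟨t, rfl, ht⟩
    exact ⟨_, ht, mem_lattice_iff.2 ⟨t, rfl, rfl⟩⟩

theorem mem_shiftedWindow {β c z : ℂ} : z ∈ shiftedWindow β c ↔ z - c ∈ totalWindow β := by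
  constructor
  · rintro ⟨w, hw, rfl⟩
    simpa using hw
  · intro h
    exact ⟨_, h, by simp⟩

/-- ℤ + ℤβ approximates every complex number within 2, because β is non-real. As L⋆ is stable under
multiplication by β, scaling by βⁿ makes the error arbitrarily small. -/
theorem dense_range_evalAt {β : ℂ} (hβ : β ^ 3 - 2 * β ^ 2 - 1 = 0) (him : β.im ≠ 0) :
    DenseRange (evalAt β) := by
  have h1 := norm_lt_one_of_root hβ him
  have hne := ne_zero_of_root hβ
  have hs (n : ℕ) (t : ℤ × ℤ × ℤ) : evalAt β (shift^[n] t) = β ^ n * evalAt β t := by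
    induction n with
    | zero => simp
    | succ n ih => rw [Function.iterate_succ_apply', evalAt_shift hβ, ih]; ring
  rw [Metric.denseRange_iff]
  intro z r hr
  obtain ⟨n, hn⟩ := exists_pow_lt_of_lt_one (by linarith : 0 < r / 2) h1
  set w := z / β ^ n with hw
  set b := w.im / β.im with hb
  set a := w.re - b * β.re with ha
  have hwab : w = a + b * β := by
    apply Complex.ext
    · simp [ha]
    · simp [hb, him]
  refine ⟨shift^[n] (⌊a⌋, ⌊b⌋, 0), ?_⟩
  have hz : z = β ^ n * w := by rw [hw]; field_simp
  have hdiff : w - evalAt β (⌊a⌋, ⌊b⌋, 0) = (Int.fract a : ℝ) + (Int.fract b : ℝ) * β := by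
    rw [hwab, evalAt_apply, Int.fract, Int.fract]
    push_cast
    ring
  rw [hs, hz, dist_eq_norm, ← mul_sub, hdiff, norm_mul, norm_pow]
  have h2 : ‖((Int.fract a : ℝ) : ℂ) + (Int.fract b : ℝ) * β‖ ≤ 2 := by
    refine (norm_add_le _ _).trans ?_
    rw [norm_mul, Complex.norm_real, Complex.norm_real, Real.norm_of_nonneg (Int.fract_nonneg _),
      Real.norm_of_nonneg (Int.fract_nonneg _)]
    nlinarith [Int.fract_lt_one a, Int.fract_lt_one b, Int.fract_nonneg b, norm_nonneg β]
  nlinarith [pow_nonneg (norm_nonneg β) n]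

theorem discreteTopology_lattice {α : ℝ} (hα : α ^ 3 - 2 * α ^ 2 - 1 = 0) {β : ℂ}
    (hβ : β ^ 3 - 2 * β ^ 2 - 1 = 0) (him : β.im ≠ 0) : DiscreteTopology (lattice α β) := by
  apply discreteTopology_of_isOpen_singleton_zero
  rw [Metric.isOpen_singleton_iff]
  refine ⟨1 / 4, by norm_num, ?_⟩
  rintro ⟨⟨x, z⟩, h⟩ hd
  obtain ⟨t, rfl, rfl⟩ := mem_lattice_iff.1 h
  rw [Subtype.dist_eq, AddSubgroup.coe_zero, dist_zero_right, Prod.norm_def, max_lt_iff,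
    Real.norm_eq_abs] at hd
  obtain ⟨ha, hb, hc⟩ := abs_coord_le hα hβ him t
  have hd1 : |evalAt α t| < 1 / 4 := hd.1
  have hd2 : ‖evalAt β t‖ < 1 / 4 := hd.2
  have key (k : ℤ) (hk : |(k : ℝ)| < 1) : k = 0 := by
    rw [← Int.abs_lt_one_iff]
    exact_mod_cast hk
  have h0 : t = 0 := by
    ext
    · exact key _ (by linarith)
    · exact key _ (by linarith)
    · exact key _ (by linarith)
  subst h0
  ext <;> simp

theorem exists_real_coord {α : ℝ} (hα : α ^ 3 - 2 * α ^ 2 - 1 = 0) {β : ℂ}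
    (hβ : β ^ 3 - 2 * β ^ 2 - 1 = 0) (him : β.im ≠ 0) (x : ℝ) (z : ℂ) :
    ∃ a b c : ℝ, x = a + b * α + c * α ^ 2 ∧ z = a + b * β + c * β ^ 2 := by
  obtain ⟨hl, hu⟩ := root_bounds hα
  obtain ⟨hp, hn⟩ := re_and_normSq_of_root hα hβ him
  have hD : 3 * α ^ 2 - 4 * α ≠ 0 := by nlinarith
  set s := z.im / β.im with hs
  have hs' : z.im = s * β.im := by rw [hs]; field_simp
  set c := (x - z.re - s * ((3 * α - 2) / 2)) / (3 * α ^ 2 - 4 * α) with hc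
  have hc' : c * (3 * α ^ 2 - 4 * α) = x - z.re - s * ((3 * α - 2) / 2) := by
    rw [hc, div_mul_cancel₀ _ hD]
  rw [hp] at hn
  refine ⟨z.re - (2 - α) / 2 * s + (α ^ 2 - 2 * α) * c, s - (2 - α) * c, c, ?_, ?_⟩
  · linear_combination -hc'
  · apply Complex.ext
    · simp [pow_two]
      rw [hp]
      linear_combination c * hn
    · simp [pow_two]
      rw [hp, hs']
      ring

/-- The compact unit cube of real coordinates maps onto the quotient: subtract integer parts. -/
theorem compactSpace_quotient_lattice {α : ℝ} (hα : α ^ 3 - 2 * α ^ 2 - 1 = 0) {β : ℂ}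
    (hβ : β ^ 3 - 2 * β ^ 2 - 1 = 0) (him : β.im ≠ 0) :
    CompactSpace ((ℝ × ℂ) ⧸ lattice α β) := by
  let f : ℝ × ℝ × ℝ → (ℝ × ℂ) ⧸ lattice α β := fun p =>
    QuotientAddGroup.mk (p.1 + p.2.1 * α + p.2.2 * α ^ 2, p.1 + p.2.1 * β + p.2.2 * β ^ 2)
  have hf : Continuous f := continuous_quotient_mk'.comp (by fun_prop)
  refine ⟨?_⟩
  convert (((isCompact_Icc (a := (0 : ℝ)) (b := 1)).prod
    ((isCompact_Icc (a := (0 : ℝ)) (b := 1)).prod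
      (isCompact_Icc (a := (0 : ℝ)) (b := 1)))).image hf)
  refine (eq_univ_of_forall fun q => ?_).symm
  obtain ⟨⟨x, z⟩, rfl⟩ := QuotientAddGroup.mk_surjective q
  obtain ⟨a, b, c, rfl, rfl⟩ := exists_real_coord hα hβ him x z
  have hfr (a : ℝ) : Int.fract a ∈ Icc (0 : ℝ) 1 :=
    ⟨Int.fract_nonneg a, (Int.fract_lt_one a).le⟩
  refine ⟨(Int.fract a, Int.fract b, Int.fract c), ⟨hfr a, hfr b, hfr c⟩, ?_⟩
  rw [QuotientAddGroup.eq]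
  refine mem_lattice_iff.2 ⟨(⌊a⌋, ⌊b⌋, ⌊c⌋), ?_, ?_⟩
  · simp only [evalAt_apply, ← Int.self_sub_floor, Prod.fst_neg]
    ring
  · simp only [evalAt_apply, ← Int.self_sub_floor, Prod.snd_neg]
    push_cast
    ring

theorem isCutProjectScheme_lattice {α : ℝ} (hα : α ^ 3 - 2 * α ^ 2 - 1 = 0) {β : ℂ}
    (hβ : β ^ 3 - 2 * β ^ 2 - 1 = 0) (him : β.im ≠ 0) : IsCutProjectScheme (lattice α β) where
  discrete := discreteTopology_lattice hα hβ him
  cocompact := compactSpace_quotient_lattice hα hβ him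
  injOn_fst := by
    rintro ⟨x, z⟩ h ⟨x', z'⟩ h' (rfl : x = x')
    obtain ⟨t, ht, rfl⟩ := mem_lattice_iff.1 h
    obtain ⟨t', ht', rfl⟩ := mem_lattice_iff.1 h'
    rw [evalAt_injective hα hβ him (ht.trans ht'.symm)]
  dense_snd := by
    rw [snd_image_lattice]
    exact dense_range_evalAt hβ him

/-! ### Lattice points are interior to the windows -/

/-- It suffices that all lattice points with conjugate near that of `t` have it in the same window,
since these conjugates are dense and the window is closed. Such a point `y` lies in a tile of some
type `j` at offset `s`; closedness places `t` in a tile of type `j` at the same offset, and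
non-overlap forces `s = 0` and `j = i`. -/
theorem evalAt_mem_interior_window {α : ℝ} (hα : α ^ 3 - 2 * α ^ 2 - 1 = 0) {β : ℂ}
    (hβ : β ^ 3 - 2 * β ^ 2 - 1 = 0) (him : β.im ≠ 0) {i : Letter} {t : ℤ × ℤ × ℤ}
    (ht : evalAt β t ∈ window β i) : evalAt β t ∈ interior (window β i) := by
  have h1 := norm_lt_one_of_root hβ him
  have h2 : 2 < α := by linarith [(root_bounds hα).1]
  have hpos := mem_positions_of_mem_window hα hβ him ht
  have hfin : {s : ℤ × ℤ × ℤ | |evalAt α s| ≤ α ^ 2 ∧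
      ‖evalAt β s‖ ≤ ‖evalAt β t‖ + 1 + 2.7}.Finite := finite_coord hα hβ him _ _
  -- For the finitely many possible offsets, non-membership in a closed window persists nearby;
  -- contrapositively, membership near the point implies membership at it.
  have hev : ∀ᶠ z in nhds (evalAt β t), ∀ s ∈ {s : ℤ × ℤ × ℤ | |evalAt α s| ≤ α ^ 2 ∧
      ‖evalAt β s‖ ≤ ‖evalAt β t‖ + 1 + 2.7}, ∀ j,
      z - evalAt β s ∈ window β j → evalAt β t - evalAt β s ∈ window β j := by
    rw [Filter.eventually_all_finite hfin]
    intro s _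
    rw [Filter.eventually_all]
    intro j
    by_cases h : evalAt β t - evalAt β s ∈ window β j
    · exact Filter.Eventually.of_forall fun _ _ => h
    · have : ∀ᶠ z in nhds (evalAt β t), z - evalAt β s ∈ (window β j)ᶜ :=
        (continuous_id.sub continuous_const).continuousAt.eventually
          ((isCompact_window h1 j).isClosed.isOpen_compl.mem_nhds h)
      filter_upwards [this] with z hz hz'
      exact absurd hz' hz
  obtain ⟨V, hV, hVo, htV⟩ := mem_nhds_iff.1
    (Filter.inter_mem hev (Metric.ball_mem_nhds (evalAt β t) one_pos))
  refine mem_interior.2 ⟨V, ?_, hVo, htV⟩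
  refine ((dense_range_evalAt hβ him).open_subset_closure_inter hVo).trans
    (closure_minimal ?_ (isCompact_window h1 i).isClosed)
  rintro _ ⟨hy, y, rfl⟩
  obtain ⟨j, l, hl, hl1, hl2⟩ := exists_tile hα (evalAt α y)
  have hlw := evalAt_mem_window hβ him hl
  have hy1 : ‖evalAt β y - evalAt β t‖ < 1 := by
    rw [← dist_eq_norm]
    exact (hV hy).2
  have hx : 0 ≤ evalAt α (y - l) ∧ evalAt α (y - l) < bond α j := by
    rw [map_sub]
    constructor <;> linarith
  have hnorm : ‖evalAt β (y - l)‖ ≤ ‖evalAt β t‖ + 1 + 2.7 := by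
    have e : evalAt β (y - l) = evalAt β t + (evalAt β y - evalAt β t) + -evalAt β l := by
      rw [map_sub]; ring
    rw [e]
    refine (norm_add₃_le).trans ?_
    rw [norm_neg]
    linarith [norm_le_of_mem_window hα hβ him hlw]
  have hmem := (hV hy).1 (y - l)
    ⟨by rw [abs_of_nonneg hx.1]; linarith [bond_le h2 j], hnorm⟩ j (by simpa using hlw)
  rw [← map_sub] at hmem
  have hpos' := mem_positions_of_mem_window hα hβ him hmem
  -- The tile at `t - (y - l)` contains the left endpoint of the tile at `t`, so the two coincide
  -- and `y = l`.
  obtain ⟨e, rfl⟩ := tile_unique h2 hpos' hpos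
    (by rw [map_sub _ t]; linarith) (by rw [map_sub _ t]; linarith)
  rw [sub_eq_self, sub_eq_zero] at e
  rwa [e]

theorem add_mem_genericShifts {α : ℝ} {β c : ℂ} (hc : c ∈ genericShifts α β) (t : ℤ × ℤ × ℤ) :
    c + evalAt β t ∈ genericShifts α β := by
  rw [genericShifts, mem_ofPred_eq, snd_image_lattice, eq_empty_iff_forall_notMem] at hc ⊢
  rintro _ ⟨⟨z, hz, rfl⟩, s, hs⟩
  refine hc (c + z) ⟨⟨z, hz, rfl⟩, s - t, ?_⟩
  rw [map_sub, hs]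
  ring

/-- A point of L⋆ lying in Ω lies in some Ω_i, hence in its interior. -/
theorem zero_mem_genericShifts {α : ℝ} (hα : α ^ 3 - 2 * α ^ 2 - 1 = 0) {β : ℂ}
    (hβ : β ^ 3 - 2 * β ^ 2 - 1 = 0) (him : β.im ≠ 0) : 0 ∈ genericShifts α β := by
  rw [genericShifts, mem_ofPred_eq, snd_image_lattice, eq_empty_iff_forall_notMem]
  rintro _ ⟨⟨z, ⟨hz, hz'⟩, rfl⟩, t, ht⟩
  simp only [zero_add] at ht
  subst ht
  obtain ⟨i, hi⟩ := mem_iUnion.1 hz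
  exact hz' (mem_iUnion.2 ⟨i, evalAt_mem_interior_window hα hβ him hi⟩)

theorem dense_genericShifts {α : ℝ} (hα : α ^ 3 - 2 * α ^ 2 - 1 = 0) {β : ℂ}
    (hβ : β ^ 3 - 2 * β ^ 2 - 1 = 0) (him : β.im ≠ 0) : Dense (genericShifts α β) := by
  refine (dense_range_evalAt hβ him).mono ?_
  rintro _ ⟨t, rfl⟩
  simpa using add_mem_genericShifts (zero_mem_genericShifts hα hβ him) t

theorem sigmaKol_eq_modelSet {α : ℝ} (hα : α ^ 3 - 2 * α ^ 2 - 1 = 0) {β : ℂ}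
    (hβ : β ^ 3 - 2 * β ^ 2 - 1 = 0) (him : β.im ≠ 0) :
    sigmaKol α = modelSet (lattice α β) (shiftedWindow β 0) := by
  ext x
  simp only [sigmaKol, endpoints_eq_image, mem_modelSet_iff, mem_shiftedWindow, sub_zero,
    totalWindow, mem_iUnion]
  constructor
  · rintro ⟨i, t, ht, rfl⟩
    exact ⟨t, rfl, i, evalAt_mem_window hβ him ht⟩
  · rintro ⟨t, rfl, i, hi⟩
    exact ⟨i, t, mem_positions_of_mem_window hα hβ him hi, rfl⟩

/-! ### Local indistinguishability and repetitivity -/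

/-- Seen from `w` and from `w'`, the same lattice vectors of length at most `r` lead into the
window. -/
def SamePattern (α : ℝ) (β : ℂ) (r : ℝ) (w w' : ℂ) : Prop :=
  ∀ t : ℤ × ℤ × ℤ, |evalAt α t| ≤ r → ‖evalAt β t‖ ≤ 5.4 →
    (w + evalAt β t ∈ totalWindow β ↔ w' + evalAt β t ∈ totalWindow β)

theorem SamePattern.symm {α r : ℝ} {β w w' : ℂ} (h : SamePattern α β r w w') :
    SamePattern α β r w' w := fun t h₁ h₂ => (h t h₁ h₂).symm

theorem SamePattern.trans {α r : ℝ} {β w w' w'' : ℂ} (h : SamePattern α β r w w')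
    (h' : SamePattern α β r w' w'') : SamePattern α β r w w'' :=
  fun t h₁ h₂ => (h t h₁ h₂).trans (h' t h₁ h₂)

theorem add_mem_patch {α : ℝ} (hα : α ^ 3 - 2 * α ^ 2 - 1 = 0) {β : ℂ}
    (hβ : β ^ 3 - 2 * β ^ 2 - 1 = 0) (him : β.im ≠ 0) {c c' : ℂ} {r : ℝ} {u v : ℤ × ℤ × ℤ}
    (hu : evalAt β u - c ∈ totalWindow β)
    (h : SamePattern α β r (evalAt β u - c) (evalAt β v - c')) {x : ℝ}
    (hx : x ∈ patch (modelSet (lattice α β) (shiftedWindow β c)) r (evalAt α u)) :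
    x + (evalAt α v - evalAt α u) ∈
      patch (modelSet (lattice α β) (shiftedWindow β c')) r (evalAt α v) := by
  obtain ⟨hx, hr⟩ := hx
  obtain ⟨s, rfl, hs⟩ := mem_modelSet_iff.1 hx
  rw [mem_shiftedWindow] at hs
  rw [Metric.mem_ball, Real.dist_eq] at hr
  have hb {z : ℂ} (hz : z ∈ totalWindow β) : ‖z‖ ≤ 2.7 := by
    obtain ⟨i, hi⟩ := mem_iUnion.1 hz
    exact norm_le_of_mem_window hα hβ him hi
  have e : evalAt β (s - u) = (evalAt β s - c) - (evalAt β u - c) := by rw [map_sub]; ring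
  -- Two points of Ω differ by at most 2 · 2.7 = 5.4, so `SamePattern` sees every relevant vector.
  have hn : ‖evalAt β (s - u)‖ ≤ 5.4 := by
    rw [e]
    refine (norm_sub_le _ _).trans ?_
    linarith [hb hs, hb hu]
  have hmem := (h (s - u) (by rw [map_sub]; exact hr.le) hn).1 (by rw [e]; simpa using hs)
  refine ⟨mem_modelSet_iff.2 ⟨v + (s - u), ?_, ?_⟩, ?_⟩
  · rw [map_add, map_sub]; ring
  · rw [mem_shiftedWindow]
    convert hmem using 1
    rw [map_add]; ring
  · rw [Metric.mem_ball, Real.dist_eq]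
    convert hr using 2
    ring

theorem patch_eq_of_samePattern {α : ℝ} (hα : α ^ 3 - 2 * α ^ 2 - 1 = 0) {β : ℂ}
    (hβ : β ^ 3 - 2 * β ^ 2 - 1 = 0) (him : β.im ≠ 0) {c c' : ℂ} {r : ℝ} {u v : ℤ × ℤ × ℤ}
    (hu : evalAt β u - c ∈ totalWindow β) (hv : evalAt β v - c' ∈ totalWindow β)
    (h : SamePattern α β r (evalAt β u - c) (evalAt β v - c')) :
    patch (modelSet (lattice α β) (shiftedWindow β c')) r (evalAt α v) =
      (fun x => x + (evalAt α v - evalAt α u)) ''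
        patch (modelSet (lattice α β) (shiftedWindow β c)) r (evalAt α u) := by
  apply Subset.antisymm
  · intro x hx
    exact ⟨_, add_mem_patch hα hβ him hv h.symm hx, by ring⟩
  · rintro _ ⟨x, hx, rfl⟩
    exact add_mem_patch hα hβ him hu h hx

theorem frontier_totalWindow_subset {β : ℂ} (hβ : ‖β‖ < 1) :
    frontier (totalWindow β) ⊆ totalWindow β \ innerWindow β := by
  intro z hz
  refine ⟨(isCompact_totalWindow hβ).isClosed.frontier_subset hz, fun h => hz.2 ?_⟩
  obtain ⟨i, hi⟩ := mem_iUnion.1 h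
  exact interior_mono (subset_iUnion (window β) i) hi

theorem sub_notMem_frontier {α : ℝ} {β c : ℂ} (hβ : ‖β‖ < 1) (hc : c ∈ genericShifts α β)
    (t : ℤ × ℤ × ℤ) : evalAt β t - c ∉ frontier (totalWindow β) := by
  intro h
  rw [genericShifts, mem_ofPred_eq, snd_image_lattice, eq_empty_iff_forall_notMem] at hc
  exact hc (evalAt β t) ⟨⟨_, frontier_totalWindow_subset hβ h, by simp⟩, t, rfl⟩

/-- For a generic shift the pattern is locally constant. -/
theorem exists_isOpen_samePattern {α : ℝ} (hα : α ^ 3 - 2 * α ^ 2 - 1 = 0) {β : ℂ}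
    (hβ : β ^ 3 - 2 * β ^ 2 - 1 = 0) (him : β.im ≠ 0) {c : ℂ} (hc : c ∈ genericShifts α β)
    (r : ℝ) {u : ℤ × ℤ × ℤ} (hu : evalAt β u - c ∈ totalWindow β) :
    ∃ V, IsOpen V ∧ evalAt β u - c ∈ V ∧
      ∀ z ∈ V, z ∈ totalWindow β ∧ SamePattern α β r (evalAt β u - c) z := by
  have h1 := norm_lt_one_of_root hβ him
  have hclosed := (isCompact_totalWindow h1).isClosed
  have hloc (t : ℤ × ℤ × ℤ) : ∀ᶠ z in nhds (evalAt β u - c),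
      (evalAt β u - c + evalAt β t ∈ totalWindow β ↔ z + evalAt β t ∈ totalWindow β) := by
    have hcont : Filter.Tendsto (fun z => z + evalAt β t) (nhds (evalAt β u - c))
        (nhds (evalAt β u - c + evalAt β t)) := (continuous_id.add continuous_const).tendsto _
    by_cases h : evalAt β u - c + evalAt β t ∈ totalWindow β
    · have hint : evalAt β u - c + evalAt β t ∈ interior (totalWindow β) := by
        by_contra hn
        refine sub_notMem_frontier h1 hc (u + t) ?_
        rw [map_add, add_sub_right_comm, hclosed.frontier_eq]
        exact ⟨h, hn⟩
      filter_upwards [hcont.eventually (isOpen_interior.mem_nhds hint)] with z hz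
      exact iff_of_true h (interior_subset hz)
    · filter_upwards [hcont.eventually (hclosed.isOpen_compl.mem_nhds h)] with z hz
      exact iff_of_false h hz
  have hall := (Filter.eventually_all_finite (finite_coord hα hβ him r 5.4)).2 fun t _ => hloc t
  -- The zero vector is added separately: it keeps `z` itself in the window, even when `r` is
  -- negative.
  obtain ⟨V, hV, hVo, huV⟩ := mem_nhds_iff.1 (Filter.inter_mem (hloc 0) hall)
  refine ⟨V, hVo, huV, fun z hz => ⟨?_, fun t h h' => (hV hz).2 t ⟨h, h'⟩⟩⟩
  have := (hV hz).1
  simp only [mem_ofPred_eq, map_zero, add_zero] at this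
  exact this.1 hu

/-- Only the source needs a generic shift: its pattern is constant on an open set, and the dense set
L⋆ - c' meets that set. -/
theorem patchesOccur_modelSet {α : ℝ} (hα : α ^ 3 - 2 * α ^ 2 - 1 = 0) {β : ℂ}
    (hβ : β ^ 3 - 2 * β ^ 2 - 1 = 0) (him : β.im ≠ 0) {c : ℂ} (hc : c ∈ genericShifts α β)
    (c' : ℂ) : PatchesOccur (modelSet (lattice α β) (shiftedWindow β c))
      (modelSet (lattice α β) (shiftedWindow β c')) := by
  intro r _ x hx
  obtain ⟨u, rfl, hu⟩ := mem_modelSet_iff.1 hx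
  rw [mem_shiftedWindow] at hu
  obtain ⟨V, hVo, huV, hV⟩ := exists_isOpen_samePattern hα hβ him hc r hu
  obtain ⟨v, hv⟩ := (dense_range_evalAt hβ him).exists_mem_open
    (hVo.preimage (continuous_id.sub continuous_const : Continuous fun z : ℂ => z - c'))
    ⟨evalAt β u - c + c', by simpa using huV⟩
  obtain ⟨hv', hs⟩ := hV _ hv
  exact ⟨evalAt α v, mem_modelSet_iff.2 ⟨v, rfl, mem_shiftedWindow.2 hv'⟩,
    patch_eq_of_samePattern hα hβ him hu hv' hs⟩

/-- The lattice points with internal part in a non-empty open set are relatively dense. -/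
theorem exists_abs_sub_le_of_isOpen {α : ℝ} (hα : α ^ 3 - 2 * α ^ 2 - 1 = 0) {β : ℂ}
    (hβ : β ^ 3 - 2 * β ^ 2 - 1 = 0) (him : β.im ≠ 0) {V : Set ℂ} (hV : IsOpen V)
    (hne : V.Nonempty) : ∃ R, ∀ y, ∃ v, evalAt β v ∈ V ∧ |evalAt α v - y| ≤ R := by
  have h1 := norm_lt_one_of_root hβ him
  have h2 : 2 < α := by linarith [(root_bounds hα).1]
  -- Finitely many lattice translates of V cover the compact set Ω. A tile found near `y` can
  -- therefore be moved into V by one of finitely many vectors.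
  obtain ⟨F, hF⟩ := (isCompact_totalWindow h1).elim_finite_subcover
    (fun s : ℤ × ℤ × ℤ => (fun z => z + evalAt β s) ⁻¹' V)
    (fun s => hV.preimage (by fun_prop)) (by
      intro z _
      obtain ⟨w, hw⟩ := hne
      obtain ⟨s, hs⟩ := (dense_range_evalAt hβ him).exists_mem_open
        (hV.preimage (by fun_prop : Continuous fun x : ℂ => z + x)) ⟨w - z, by simpa using hw⟩
      exact mem_iUnion.2 ⟨s, hs⟩)
  refine ⟨α ^ 2 + ∑ s ∈ F, |evalAt α s|, fun y => ?_⟩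
  obtain ⟨i, l, hl, hl1, hl2⟩ := exists_tile hα y
  obtain ⟨s, hsF, hs⟩ := mem_iUnion₂.1 (hF (mem_iUnion.2 ⟨i, evalAt_mem_window hβ him hl⟩))
  refine ⟨l + s, by rw [map_add]; exact hs, ?_⟩
  have h3 : |evalAt α s| ≤ ∑ s ∈ F, |evalAt α s| :=
    Finset.single_le_sum (f := fun s => |evalAt α s|) (fun _ _ => abs_nonneg _) hsF
  have h4 := bond_le h2 i
  have h5 := abs_le.1 (le_refl |evalAt α s|)
  rw [map_add, abs_le]
  constructor <;> linarith [abs_nonneg (evalAt α s), sq_nonneg α]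

/-- An r-patch is determined by a subset of a finite set of lattice vectors. Each pattern that
occurs does so on an open set, hence with bounded gaps, and finitely many bounds have a maximum. -/
theorem repetitive_modelSet {α : ℝ} (hα : α ^ 3 - 2 * α ^ 2 - 1 = 0) {β : ℂ}
    (hβ : β ^ 3 - 2 * β ^ 2 - 1 = 0) (him : β.im ≠ 0) {c : ℂ} (hc : c ∈ genericShifts α β) :
    Repetitive (modelSet (lattice α β) (shiftedWindow β c)) := by
  intro r hr
  set F := {t : ℤ × ℤ × ℤ | |evalAt α t| ≤ r ∧ ‖evalAt β t‖ ≤ 5.4}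
  have hF : F.Finite := finite_coord hα hβ him r 5.4
  let pat : ℤ × ℤ × ℤ → Set (ℤ × ℤ × ℤ) := fun u =>
    {t ∈ F | evalAt β u - c + evalAt β t ∈ totalWindow β}
  have hpat {u v : ℤ × ℤ × ℤ} (h : pat u = pat v) :
      SamePattern α β r (evalAt β u - c) (evalAt β v - c) := by
    intro t ht ht'
    have := congrArg (t ∈ ·) h
    simpa [pat, F, ht, ht'] using this
  have hR (Q : Set (ℤ × ℤ × ℤ)) : ∃ R, ∀ u, pat u = Q → evalAt β u - c ∈ totalWindow β →
      ∀ y, ∃ v, evalAt β v - c ∈ totalWindow β ∧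
        SamePattern α β r (evalAt β u - c) (evalAt β v - c) ∧ |evalAt α v - y| ≤ R := by
    by_cases h : ∃ u, pat u = Q ∧ evalAt β u - c ∈ totalWindow β
    · obtain ⟨u, rfl, hu⟩ := h
      obtain ⟨V, hVo, huV, hV⟩ := exists_isOpen_samePattern hα hβ him hc r hu
      obtain ⟨R, hR⟩ := exists_abs_sub_le_of_isOpen hα hβ him
        (hVo.preimage (by fun_prop : Continuous fun z : ℂ => z - c)) ⟨evalAt β u, huV⟩
      refine ⟨R, fun u' hu' _ y => ?_⟩
      obtain ⟨v, hv, hvy⟩ := hR y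
      exact ⟨v, (hV _ hv).1, (hpat hu').trans (hV _ hv).2, hvy⟩
    -- A pattern that never occurs needs no bound; 0 is a dummy value.
    · exact ⟨0, fun u hu hu' => absurd ⟨u, hu, hu'⟩ h⟩
  choose R hR using hR
  obtain ⟨M, hM⟩ := (hF.finite_subsets.image R).bddAbove
  refine ⟨|M| + r + 1, by positivity, fun y x hx => ?_⟩
  obtain ⟨u, rfl, hu⟩ := mem_modelSet_iff.1 hx
  rw [mem_shiftedWindow] at hu
  obtain ⟨v, hv, hs, hvy⟩ := hR (pat u) u rfl hu y
  have hRM : R (pat u) ≤ M := hM ⟨pat u, fun t ht => ht.1, rfl⟩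
  refine ⟨evalAt α v, mem_modelSet_iff.2 ⟨v, rfl, mem_shiftedWindow.2 hv⟩,
    patch_eq_of_samePattern hα hβ him hu hv hs, fun z hz => ?_⟩
  have hz2 := hz.2
  rw [Metric.mem_ball, Real.dist_eq] at hz2 ⊢
  have := abs_sub_le z (evalAt α v) y
  linarith [le_abs_self M]

/-! ### The boundaries of the windows are null sets -/

/-- The real determinant of multiplication by β is the field norm |β|². -/
theorem volume_image_affine (β t : ℂ) (S : Set ℂ) :
    volume ((fun z => β * z + t) '' S) = ENNReal.ofReal (‖β‖ ^ 2) * volume S := by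
  have h : (fun z => β * z + t) '' S = (fun z => z + t) '' (LinearMap.mul ℝ ℂ β '' S) := by
    rw [image_image]
    rfl
  have hdet : LinearMap.det (LinearMap.mul ℝ ℂ β) = ‖β‖ ^ 2 := by
    rw [← Complex.normSq_eq_norm_sq, ← Algebra.norm_complex_apply, Algebra.norm_apply]
    rfl
  rw [h, image_add_right, measure_preimage_add_right, Measure.addHaar_image_linearMap, hdet,
    abs_of_nonneg (by positivity)]

theorem frontier_image_affine {β : ℂ} (hβ : β ≠ 0) (t : ℂ) (S : Set ℂ) :
    frontier ((fun z => β * z + t) '' S) = (fun z => β * z + t) '' frontier S :=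
  (((Homeomorph.mulLeft₀ β hβ).trans (Homeomorph.addRight t)).image_frontier S).symm

theorem frontier_union_subset_union (S T : Set ℂ) :
    frontier (S ∪ T) ⊆ frontier S ∪ frontier T :=
  (frontier_union_subset S T).trans (union_subset_union inter_subset_left inter_subset_right)

theorem volume_frontier_window {α : ℝ} (hα : α ^ 3 - 2 * α ^ 2 - 1 = 0) {β : ℂ}
    (hβ : β ^ 3 - 2 * β ^ 2 - 1 = 0) (him : β.im ≠ 0) (i : Letter) :
    volume (frontier (window β i)) = 0 := by
  have h1 := norm_lt_one_of_root hβ him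
  have hne := ne_zero_of_root hβ
  have hsys := isWindowSystem_window h1
  have hn := norm_sq_of_root hα hβ him
  obtain ⟨hl, hu⟩ := root_bounds hα
  set k := ‖β‖ ^ 2 with hk
  -- The product of the three roots is 1, so each map contracts area by exactly 1/α, the inverse of
  -- the inflation factor.
  have hkα : k * α = 1 := by rw [hn]; linear_combination hα
  have hk0 : 0 < k := by rw [hn]; nlinarith
  have hcpt (j : Letter) : IsCompact (frontier (window β j)) :=
    (isCompact_window h1 j).of_isClosed_subset isClosed_frontier
      (isCompact_window h1 j).isClosed.frontier_subset
  have hfin (j : Letter) : volume (frontier (window β j)) ≠ ∞ := (hcpt j).measure_ne_top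
  have himg (t : ℂ) (j : Letter) :
      volume.real ((fun z => β * z + t) '' frontier (window β j)) =
        k * volume.real (frontier (window β j)) := by
    rw [measureReal_def, volume_image_affine, ENNReal.toReal_mul,
      ENNReal.toReal_ofReal (by positivity)]
    rfl
  have himg0 (j : Letter) : volume.real ((fun z => β * z) '' frontier (window β j)) =
      k * volume.real (frontier (window β j)) := by simpa using himg 0 j
  have hfr0 (S : Set ℂ) : frontier ((fun z => β * z) '' S) = (fun z => β * z) '' frontier S := by
    simpa using frontier_image_affine hne 0 S
  have hifin (t : ℂ) (j : Letter) :
      volume ((fun z => β * z + t) '' frontier (window β j)) ≠ ∞ :=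
    ((hcpt j).image (by fun_prop)).measure_ne_top
  have hifin0 (j : Letter) : volume ((fun z => β * z) '' frontier (window β j)) ≠ ∞ :=
    ((hcpt j).image (by fun_prop)).measure_ne_top
  set a := volume.real (frontier (window β A)) with ha
  set b := volume.real (frontier (window β B)) with hb
  set c := volume.real (frontier (window β C)) with hc
  have hsubA : frontier (window β A) ⊆ (fun z => β * z) '' frontier (window β A) ∪
      (fun z => β * z) '' frontier (window β B) := by
    conv_lhs => rw [hsys.eq_A]
    rw [← hfr0, ← hfr0]
    exact frontier_union_subset_union _ _
  have hsubB : frontier (window β B) ⊆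
      (fun z => β * z + (β ^ 2 - β)) '' frontier (window β A) ∪
      (fun z => β * z + (β ^ 2 - β)) '' frontier (window β B) ∪
      (fun z => β * z) '' frontier (window β C) := by
    conv_lhs => rw [hsys.eq_B]
    rw [← hfr0, ← frontier_image_affine hne, ← frontier_image_affine hne]
    exact (frontier_union_subset_union _ _).trans
      (union_subset_union_left _ (frontier_union_subset_union _ _))
  have hsubC : frontier (window β C) = (fun z => β * z + β ^ 2) '' frontier (window β A) := by
    conv_lhs => rw [hsys.eq_C]
    rw [← frontier_image_affine hne]
  have hu1 : volume.real ((fun z => β * z) '' frontier (window β A) ∪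
      (fun z => β * z) '' frontier (window β B)) ≤ k * a + k * b := by
    rw [ha, hb, ← himg0, ← himg0]
    exact measureReal_union_le _ _
  have hA : a ≤ k * a + k * b :=
    (measureReal_mono hsubA (measure_union_ne_top (hifin0 A) (hifin0 B))).trans hu1
  have hB : b ≤ k * a + k * b + k * c := by
    refine (measureReal_mono hsubB (measure_union_ne_top (measure_union_ne_top
      (hifin _ A) (hifin _ B)) (hifin0 C))).trans ((measureReal_union_le _ _).trans ?_)
    rw [himg0]
    gcongr
    refine (measureReal_union_le _ _).trans ?_
    rw [himg, himg]
  have hC : c = k * a := by rw [hc, hsubC, himg]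
  -- Weight the three relations by α² - α, α and 1. Both sides then have the same sum, so no
  -- inequality can be strict.
  have hAeq : k * a + k * b ≤ a := by
    have hw : 0 < α ^ 2 - α := by nlinarith
    have key : (α ^ 2 - α) * (k * a + k * b) + α * (k * a + k * b + k * c) + k * a =
        (α ^ 2 - α) * a + α * b + c := by
      linear_combination (α ^ 2 * a - α * a + α * b + c) * hkα - k * a * hα
    nlinarith
  -- Equality of areas makes the covering of ∂Ω_A exact up to a null set.
  have hae : volume ((fun z => β * z) '' frontier (window β A) \ frontier (window β A)) = 0 := by
    have hfinU := measure_union_ne_top (hifin0 A) (hifin0 B)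
    have hd := measureReal_sdiff (μ := volume) hsubA isClosed_frontier.measurableSet hfinU
    have h0 : volume.real (((fun z => β * z) '' frontier (window β A) ∪
        (fun z => β * z) '' frontier (window β B)) \ frontier (window β A)) = 0 :=
      le_antisymm (by rw [hd]; linarith) measureReal_nonneg
    rw [measureReal_eq_zero_iff (measure_ne_top_of_subset sdiff_subset hfinU)] at h0
    exact measure_mono_null (sdiff_subset_sdiff_left subset_union_left) h0
  have hiter (n : ℕ) :
      volume ((fun z => β ^ n * z) '' frontier (window β A) \ frontier (window β A)) = 0 := by
    induction n with
    | zero => simp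
    | succ n ih =>
      refine measure_mono_null (t := (fun z => β * z) '' frontier (window β A) \
        frontier (window β A) ∪ (fun z => β * z + 0) ''
          ((fun z => β ^ n * z) '' frontier (window β A) \ frontier (window β A))) ?_ ?_
      · rintro _ ⟨⟨z, hz, rfl⟩, hz'⟩
        by_cases h : β ^ n * z ∈ frontier (window β A)
        · exact Or.inl ⟨⟨_, h, by ring⟩, hz'⟩
        · exact Or.inr ⟨_, ⟨⟨z, hz, rfl⟩, h⟩, by ring⟩
      · rw [measure_union_null_iff, volume_image_affine, ih]
        exact ⟨hae, mul_zero _⟩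
  have hA0 : a = 0 := by
    have h0 : (0 : ℂ) ∈ interior (window β A) := by
      simpa using evalAt_mem_interior_window hα hβ him (evalAt_mem_window hβ him zero_mem_positions)
    obtain ⟨ε, hε, hball⟩ := Metric.mem_nhds_iff.1 (isOpen_interior.mem_nhds h0)
    obtain ⟨n, hn⟩ := exists_pow_lt_of_lt_one (by positivity : 0 < ε / 3) h1
    -- As |z| ≤ 2.7 < 3 on Ω_A, the choice of n puts βⁿ∂Ω_A inside a ball around 0 in the interior
    -- of Ω_A, disjoint from ∂Ω_A. The null difference is therefore all of βⁿ∂Ω_A.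
    have hdiff : (fun z => β ^ n * z) '' frontier (window β A) \ frontier (window β A) =
        (fun z => β ^ n * z + 0) '' frontier (window β A) := by
      simp only [add_zero]
      rw [sdiff_eq_left, Set.disjoint_left]
      rintro _ ⟨z, hz, rfl⟩ hz'
      refine hz'.2 (hball ?_)
      have := norm_le_of_mem_window hα hβ him ((isCompact_window h1 A).isClosed.frontier_subset hz)
      rw [mem_ball_zero_iff, norm_mul, norm_pow]
      nlinarith [norm_nonneg z, pow_nonneg (norm_nonneg β) n]
    have h2 := hiter n
    rw [hdiff, volume_image_affine, mul_eq_zero, ENNReal.ofReal_eq_zero] at h2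
    rcases h2 with h2 | h2
    · have : 0 < ‖β ^ n‖ := norm_pos_iff.2 (pow_ne_zero n hne)
      exact absurd h2 (not_le.2 (by positivity))
    · rw [ha, measureReal_def, h2, ENNReal.toReal_zero]
  have hzero : volume.real (frontier (window β i)) = 0 := by
    cases i
    · exact hA0
    · have hb0 : 0 ≤ b := measureReal_nonneg
      change b = 0
      rw [hA0] at hAeq
      nlinarith
    · change c = 0
      rw [hC, hA0, mul_zero]
  rwa [measureReal_eq_zero_iff (hfin i)] at hzero

theorem frontier_iUnion_letter_subset (f : Letter → Set ℂ) :
    frontier (⋃ i, f i) ⊆ ⋃ i, frontier (f i) := by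
  have h : ⋃ i, f i = f A ∪ f B ∪ f C := by
    ext z
    simp only [mem_iUnion, mem_union]
    constructor
    · rintro ⟨i, hi⟩
      cases i <;> simp [hi]
    · rintro ((h | h) | h) <;> exact ⟨_, h⟩
  rw [h]
  refine (frontier_union_subset_union _ _).trans (union_subset
    ((frontier_union_subset_union _ _).trans (union_subset ?_ ?_)) ?_) <;>
  exact subset_iUnion (fun i => frontier (f i)) _

theorem isGenericModelSet_of_mem_genericShifts {α : ℝ} (hα : α ^ 3 - 2 * α ^ 2 - 1 = 0) {β : ℂ}
    (hβ : β ^ 3 - 2 * β ^ 2 - 1 = 0) (him : β.im ≠ 0) {c : ℂ} (hc : c ∈ genericShifts α β) :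
    IsGenericModelSet (lattice α β) (shiftedWindow β c) := by
  have h1 := norm_lt_one_of_root hβ him
  have hcpt := (isCompact_totalWindow h1).image (by fun_prop : Continuous fun z : ℂ => c + z)
  have hfr : frontier (shiftedWindow β c) = (fun z => c + z) '' frontier (totalWindow β) :=
    ((Homeomorph.addLeft c).image_frontier _).symm
  refine ⟨⟨⟨isCutProjectScheme_lattice hα hβ him, hcpt.closure, ?_⟩, ?_⟩, ?_⟩
  · have hint : interior (shiftedWindow β c) = (fun z => c + z) '' interior (totalWindow β) :=
      ((Homeomorph.addLeft c).image_interior _).symm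
    rw [hint]
    refine Nonempty.image _ ⟨evalAt β 0, interior_mono (subset_iUnion (window β) A) ?_⟩
    exact evalAt_mem_interior_window hα hβ him (evalAt_mem_window hβ him zero_mem_positions)
  · rw [hfr, image_add_left, measure_preimage_add]
    exact measure_mono_null (frontier_iUnion_letter_subset (window β))
      (measure_iUnion_null (volume_frontier_window hα hβ him))
  · rw [snd_image_lattice, hfr, eq_empty_iff_forall_notMem]
    rintro _ ⟨⟨t, rfl⟩, z, hz, hzt⟩
    refine sub_notMem_frontier h1 hc t ?_
    rw [← hzt]
    simpa using hz

end Kol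

theorem mainTheorem10 (α : ℝ) (hα : α ^ 3 - 2 * α ^ 2 - 1 = 0)
    (β : ℂ) (hβ : β ^ 3 - 2 * β ^ 2 - 1 = 0) (hβ_im : β.im ≠ 0) :
    Dense (Kol.genericShifts α β) ∧
    (∀ c ∈ Kol.genericShifts α β,
      Kol.Repetitive (Kol.modelSet (Kol.lattice α β) (Kol.shiftedWindow β c)) ∧
      Kol.IsGenericModelSet (Kol.lattice α β) (Kol.shiftedWindow β c)) ∧
    (∀ c ∈ Kol.genericShifts α β, ∀ c' ∈ Kol.genericShifts α β,
      Kol.LocallyIndistinguishable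
        (Kol.modelSet (Kol.lattice α β) (Kol.shiftedWindow β c))
        (Kol.modelSet (Kol.lattice α β) (Kol.shiftedWindow β c'))) ∧
    (∀ c ∈ Kol.genericShifts α β,
      Kol.LocallyIndistinguishable (Kol.sigmaKol α)
        (Kol.modelSet (Kol.lattice α β) (Kol.shiftedWindow β c))) := by
  have hLI : ∀ c ∈ Kol.genericShifts α β, ∀ c' ∈ Kol.genericShifts α β,
      Kol.LocallyIndistinguishable
        (Kol.modelSet (Kol.lattice α β) (Kol.shiftedWindow β c))
        (Kol.modelSet (Kol.lattice α β) (Kol.shiftedWindow β c')) := fun c hc c' hc' =>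
    ⟨Kol.patchesOccur_modelSet hα hβ hβ_im hc c', Kol.patchesOccur_modelSet hα hβ hβ_im hc' c⟩
  refine ⟨Kol.dense_genericShifts hα hβ hβ_im, fun c hc =>
    ⟨Kol.repetitive_modelSet hα hβ hβ_im hc,
      Kol.isGenericModelSet_of_mem_genericShifts hα hβ hβ_im hc⟩, hLI, fun c hc => ?_⟩
  rw [Kol.sigmaKol_eq_modelSet hα hβ hβ_im]
  exact hLI 0 (Kol.zero_mem_genericShifts hα hβ hβ_im) c hc
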